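/- Let $F=\mathbb F_q$ be a finite field with $q$ elements, $K=\mathbb F_{q^m}$ a finite extension, $\ell\ge 0$ and $n_1,\dots,n_\ell\ge 0$ integers, and $n=n_1+\dots+n_\ell\ge 0$. Let $a_1,\dots,a_\ell\in K$ be nonzero and from pairwise distinct $\sigma$-conjugacy classes, i.e. for $l\ne l'$ there is no $c\in K\setminus\{0\}$ with $a_{l'}=c^{q}a_l c^{-1}$. Let $R_n=K[\beta_{l,t}: 1\le l\le \ell,\ 1\le t\le n_l]$ be the commutative polynomial ring in $n$ variables, $\sigma:R_n\to R_n$, $\sigma(x)=x^q$, and let $R_n[X;\sigma]$ be the skew polynomial ring with the rule $Xc=\sigma(c)X$ for $c\in R_n$; put $\deg 0=-\infty$. Number the pairs $(l,t)$ by $j=\varphi(l,t)=t+\sum_{r<l}n_r\in[n]$ and set $\alpha_j=a_l\beta_{l,t}^{q-1}$ for $j=\varphi(l,t)$. We say that $g$ right divides $f$ if $f=hg$ for some $h\in R_n[X;\sigma]$. The $\mathrm{gcrd}$ of a family is a monic skew polynomial of largest degree that right divides all members; the $\mathrm{lclm}$ of a family is a monic skew polynomial of lowest degree that is right divisible by all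 members. For $Z\subseteq[n]$ and $\tau\ge0$ set $$\mathsf f(Z,\tau)=X^{\tau}\cdot\mathrm{lclm}\{X-\alpha_j: j\in Z\}\in R_n[X;\sigma].$$ **(A)** Let $k\ge s\ge1$ and, for $i\in[s]$, let $Z_i\subseteq[n]$, $\tau_i\ge0$ with $|Z_i|+\tau_i\le k-1$, and $f_i=\mathsf f(Z_i,\tau_i)$. The lclm's that define the $f_i$, and $\mathrm{gcrd}_{i\in\Omega}f_i$ for every nonempty $\Omega\subseteq[s]$, exist and are unique, and the following are equivalent: (i) for all $g_1,\dots,g_s\in R_n[X;\sigma]$ with $\deg(g_if_i)\le k-1$ for all $i$, $\sum_{i=1}^s g_if_i=0$ implies $g_1=\dots=g_s=0$; (ii) for every nonempty $\Omega\subseteq[s]$, $\;k-\deg(\mathrm{gcrd}_{i\in\Omega}f_i)\ge\sum_{i\in\Omega}(k-\deg f_i)$. **(B)** In the situation of (A), write $f_i=\sum_j f_{i,j}X^j$ and let $S(f_i)$ be the $(k-\tau_i-|Z_i|)\times k$ matrix over $R_n$ whose entry in row $r$ and column $c$ (both counted from $0$) is $\sigma^r(f_{i,c-r})$ if $c\ge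 r$ and $0$ otherwise. Let $M(f_1,\dots,f_s)$ be the matrix obtained by stacking $S(f_1),\dots,S(f_s)$. Then $M(f_1,\dots,f_s)$ has full row rank if and only if for every nonempty $\Omega\subseteq[s]$ $$k-\Big|\bigcap_{i\in\Omega}Z_i\Big|-\min_{i\in\Omega}\tau_i\;\ge\;\sum_{i\in\Omega}(k-\tau_i-|Z_i|).$$ **(C)** Let $Z_1,\dots,Z_k\subseteq[n]$ with $|Z_i|=k-1$ for all $i$, and let $T\in R_n^{k\times k}$ be the matrix whose $i$-th row consists of the coefficients of $X^0,\dots,X^{k-1}$ in $\mathsf f(Z_i,0)$. Then $\det T$ is a nonzero polynomial in $R_n$ if and only if the GM–MDS condition holds: $\big|\bigcap_{i\in\Omega}Z_i\big|+|\Omega|\le k$ for every nonempty $\Omega\subseteq[k]$. -/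

import Mathlib

/-! ### Skew polynomials: degree, right divisibility, gcrd and lclm -/

namespace SkewCode

section General

variable {R : Type*} [CommRing R]

/-- Degree of a skew polynomial, with `deg 0 = ⊥` (that is, `-∞`). -/
def degree (p : SkewPolynomial R) : WithBot ℕ := p.support.max

/-- Degree as a natural number (only meaningful for nonzero skew polynomials). -/
def natDegree (p : SkewPolynomial R) : ℕ := (degree p).unbotD 0

/-- The leading coefficient is `1`. -/
def IsMonic (p : SkewPolynomial R) : Prop := p.coeff (natDegree p) = 1

variable [MulSemiringAction (Multiplicative ℕ) R]

/-- `g` right divides `f`: `f = h * g` for some `h`. (Mathlib's `g ∣ f` is left divisibility.) -/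
def RightDvd (g f : SkewPolynomial R) : Prop := ∃ h : SkewPolynomial R, f = h * g

/-- `g` is a greatest common right divisor of the set `S`: a monic skew polynomial of the largest
degree that right divides every element of `S`. -/
def IsGcrd (S : Set (SkewPolynomial R)) (g : SkewPolynomial R) : Prop :=
  IsMonic g ∧ (∀ f ∈ S, RightDvd g f) ∧
    ∀ h : SkewPolynomial R, IsMonic h → (∀ f ∈ S, RightDvd h f) → degree h ≤ degree g

/-- `m` is a least common left multiple of the set `S`: a monic skew polynomial of the lowest
degree that is right divisible by every element of `S`. -/
def IsLclm (S : Set (SkewPolynomial R)) (m : SkewPolynomial R) : Prop :=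
  IsMonic m ∧ (∀ f ∈ S, RightDvd f m) ∧
    ∀ h : SkewPolynomial R, IsMonic h → (∀ f ∈ S, RightDvd f h) → degree m ≤ degree h

open Classical in
/-- The gcrd of a set of skew polynomials (`0` if there is none). -/
noncomputable def gcrd (S : Set (SkewPolynomial R)) : SkewPolynomial R :=
  if h : ∃ g, IsGcrd S g then h.choose else 0

open Classical in
/-- The lclm of a set of skew polynomials (`0` if there is none). -/
noncomputable def lclm (S : Set (SkewPolynomial R)) : SkewPolynomial R :=
  if h : ∃ m, IsLclm S m then h.choose else 0

theorem isGcrd_gcrd {S : Set (SkewPolynomial R)} (h : ∃ g, IsGcrd S g) : IsGcrd S (gcrd S) := by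
  unfold gcrd
  rw [dif_pos h]
  exact h.choose_spec

theorem isLclm_lclm {S : Set (SkewPolynomial R)} (h : ∃ m, IsLclm S m) : IsLclm S (lclm S) := by
  unfold lclm
  rw [dif_pos h]
  exact h.choose_spec

end General

/-! ### The coefficient ring `R_n` with its Frobenius, and the ring `R_n[X;σ]`

`F` is the field with `q` elements, `K` is the extension `𝔽_{q^m}`, and `nl l` is the length of
block `l`, so that `n = ∑ l, nl l`. -/

section Rn

/-- The commutative polynomial ring over `K` in the variables `β_{l,t}`. -/
def Rn (F K : Type*) [Field F] [Fintype F] [Field K] [Algebra F K] {ℓ : ℕ} (nl : Fin ℓ → ℕ) :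
    Type _ :=
  MvPolynomial (Σ l : Fin ℓ, Fin (nl l)) K

variable {F K : Type*} [Field F] [Fintype F] [Field K] [Algebra F K] {ℓ : ℕ} {nl : Fin ℓ → ℕ}

noncomputable instance : CommRing (Rn F K nl) :=
  inferInstanceAs (CommRing (MvPolynomial (Σ l : Fin ℓ, Fin (nl l)) K))

noncomputable instance : Algebra F (Rn F K nl) :=
  inferInstanceAs (Algebra F (MvPolynomial (Σ l : Fin ℓ, Fin (nl l)) K))

/-- The element `a ∈ K` as a constant of `R_n`. -/
noncomputable def const (F : Type*) {K : Type*} [Field F] [Fintype F] [Field K] [Algebra F K]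
    {ℓ : ℕ} (nl : Fin ℓ → ℕ) (a : K) : Rn F K nl :=
  (MvPolynomial.C a : MvPolynomial (Σ l : Fin ℓ, Fin (nl l)) K)

/-- The variable `β_{l,t}` of `R_n`. -/
noncomputable def beta (F K : Type*) [Field F] [Fintype F] [Field K] [Algebra F K]
    {ℓ : ℕ} (nl : Fin ℓ → ℕ) (p : Σ l : Fin ℓ, Fin (nl l)) : Rn F K nl :=
  (MvPolynomial.X p : MvPolynomial (Σ l : Fin ℓ, Fin (nl l)) K)

/-- The Frobenius endomorphism `σ : x ↦ x ^ q` of `R_n`. -/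
noncomputable def sigma (F K : Type*) [Field F] [Fintype F] [Field K] [Algebra F K]
    {ℓ : ℕ} (nl : Fin ℓ → ℕ) : Rn F K nl →+* Rn F K nl :=
  (FiniteField.frobeniusAlgHom F (Rn F K nl)).toRingHom

theorem sigma_apply (x : Rn F K nl) : sigma F K nl x = x ^ Fintype.card F := rfl

/-- `σ` raises the coefficients and the variables to the power `q`:
`∑ a_i β^i ↦ ∑ a_i^q β^{q i}`. -/
theorem sigma_eq_sum (x : MvPolynomial (Σ l : Fin ℓ, Fin (nl l)) K) :
    sigma F K nl x = ∑ d ∈ x.support,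
      MvPolynomial.monomial (Fintype.card F • d) (x.coeff d ^ Fintype.card F) := by
  have h : sigma F K nl x = FiniteField.frobeniusAlgHom F
      (MvPolynomial (Σ l : Fin ℓ, Fin (nl l)) K) x := rfl
  rw [h]
  conv_lhs => rw [x.as_sum, map_sum]
  refine Finset.sum_congr rfl fun d _ => ?_
  exact MvPolynomial.monomial_pow

/-- `Multiplicative ℕ` acts on `R_n` through the powers of `σ`; this is how Mathlib's
`SkewPolynomial (Rn F K nl)` becomes the skew polynomial ring `R_n[X;σ]`. -/
noncomputable instance : MulSemiringAction (Multiplicative ℕ) (Rn F K nl) :=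
  MulSemiringAction.compHom _ (powersHom (Rn F K nl →+* Rn F K nl) (sigma F K nl))

theorem phi_eq_sigma : (SkewPolynomial.φ : Rn F K nl →+* Rn F K nl) = sigma F K nl := by
  ext x
  change ((sigma F K nl) ^ (1 : ℕ)) x = _
  rw [pow_one]

/-- The commutation rule `X a = σ(a) X` of `R_n[X;σ]`. -/
theorem X_mul_C (c : Rn F K nl) :
    (SkewPolynomial.X : SkewPolynomial (Rn F K nl)) * SkewPolynomial.C c =
      SkewPolynomial.C (sigma F K nl c) * SkewPolynomial.X := by
  rw [← phi_eq_sigma, SkewPolynomial.C_mul_X_eq_monomial, SkewPolynomial.X,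
    SkewPolynomial.monomial_mul_C]
  simp

end Rn

section Codes

variable {F K : Type*} [Field F] [Fintype F] [Field K] [Algebra F K] {ℓ : ℕ} {nl : Fin ℓ → ℕ}

/-- `a` and `b` are `σ`-conjugate: `b = σ(c) a c⁻¹` for some nonzero `c`, where `σ(c) = c ^ q`. -/
def SigmaConj (F : Type*) {K : Type*} [Fintype F] [Field K] (a b : K) : Prop :=
  ∃ c : K, c ≠ 0 ∧ b = c ^ Fintype.card F * a * c⁻¹

/-- The code locator `α_j = a_l β_{l,t}^{q-1}`, where `j = φ(l,t)`; the bijection `φ` numbers the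
variables `β_{l,t}` consecutively, block by block. -/
noncomputable def locator (F : Type*) {K : Type*} [Field F] [Fintype F] [Field K] [Algebra F K]
    {ℓ : ℕ} {nl : Fin ℓ → ℕ} (a : Fin ℓ → K) (j : Fin (∑ l, nl l)) : Rn F K nl :=
  const F nl (a (finSigmaFinEquiv.symm j).1) *
    beta F K nl (finSigmaFinEquiv.symm j) ^ (Fintype.card F - 1)

/-- The set of the skew polynomials `X - α_j`, `j ∈ Z`. -/
noncomputable def linearFactors (F : Type*) {K : Type*} [Field F] [Fintype F] [Field K] [Algebra F K]
    {ℓ : ℕ} {nl : Fin ℓ → ℕ} (a : Fin ℓ → K) (Z : Finset (Fin (∑ l, nl l))) :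
    Set (SkewPolynomial (Rn F K nl)) :=
  {p | ∃ j ∈ Z, p = SkewPolynomial.X - SkewPolynomial.C (locator F a j)}

/-- The skew polynomial `𝖿(Z,τ) = X^τ · lclm {X - α_j : j ∈ Z}` of `R_n[X;σ]`. -/
noncomputable def skewF (F : Type*) {K : Type*} [Field F] [Fintype F] [Field K] [Algebra F K]
    {ℓ : ℕ} {nl : Fin ℓ → ℕ} (a : Fin ℓ → K) (Z : Finset (Fin (∑ l, nl l))) (τ : ℕ) :
    SkewPolynomial (Rn F K nl) :=
  SkewPolynomial.X ^ τ * lclm (linearFactors F a Z)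

/-- The `a × b` matrix whose row `r` (counted from `0`) is
`(0, …, 0, σ^r(u_0), σ^r(u_1), …)` with `r` leading zeros, cut off after `b` entries. -/
noncomputable def shiftMat (a b : ℕ) (u : SkewPolynomial (Rn F K nl)) :
    Matrix (Fin a) (Fin b) (Rn F K nl) :=
  fun r c => if (r : ℕ) ≤ c then (sigma F K nl)^[r] (u.coeff (c - r)) else 0

/-- The matrix `M(f_1, …, f_s)` for `f_i = 𝖿(Z_i,τ_i)`: the matrices `S(f_i)` of size
`(k - τ_i - |Z_i|) × k`, stacked on top of each other. -/
noncomputable def stackedMat (F : Type*) {K : Type*} [Field F] [Fintype F] [Field K] [Algebra F K]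
    {ℓ : ℕ} {nl : Fin ℓ → ℕ} (a : Fin ℓ → K) (k : ℕ) {s : ℕ}
    (Z : Fin s → Finset (Fin (∑ l, nl l))) (τ : Fin s → ℕ) :
    Matrix (Σ i : Fin s, Fin (k - τ i - (Z i).card)) (Fin k) (Rn F K nl) :=
  fun p c => shiftMat (k - τ p.1 - (Z p.1).card) k (skewF F a (Z p.1) (τ p.1)) p.2 c

/-- The matrix `T`: its `i`-th row consists of the coefficients of `X^0, …, X^{k-1}` in the minimal
polynomial `f_i = 𝖿(Z_i,0)` of the locators indexed by `Z_i`. -/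
noncomputable def coeffMat (F : Type*) {K : Type*} [Field F] [Fintype F] [Field K] [Algebra F K]
    {ℓ : ℕ} {nl : Fin ℓ → ℕ} (a : Fin ℓ → K) {k : ℕ}
    (Z : Fin k → Finset (Fin (∑ l, nl l))) : Matrix (Fin k) (Fin k) (Rn F K nl) :=
  fun i j => (skewF F a (Z i) 0).coeff j

end Codes

end SkewCode

/-!
The theorem reduces to one equivalence. Write `f_i = 𝖿(Z_i,τ_i) = X^{τ_i} m_{Z_i}`, where `m_Z` is the
lclm of the `X - α_j`, `j ∈ Z`. There is no nontrivial relation `∑ g_i f_i = 0` with terms of degree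
less than `k` if and only if `k - |⋂ Z_i| - min τ_i ≥ ∑ (k - τ_i - |Z_i|)` for every nonempty set of
indices (`noRelation_iff_dim`). The rows of the stacked matrix are the coefficient vectors of the
`X^r f_i`, so that the rank (`noRelation_iff_rank`) and, if all degrees are `k - 1`, the determinant
(`noRelation_iff_det`) detect the same relations.

*Minimal skew polynomials.* The coefficient ring is a left module over `R_n[X;σ]` on which `X` acts as
`b ↦ a_l σ(b)` (`evalHom`), and `X - α_j` right divides `f` exactly if `f` annihilates `β_j` under
the action belonging to the block of `j`. The lclm `m_Z` is built up one locator at a time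
(`IsMinPoly.insert`): if `G` is the value of `m_Z` at the next variable `β_j`, then
`m_{Z ∪ {j}} = (X - a_l G^{q-1}) m_Z`. All coefficients stay in `R_n`, and `G ≠ 0` because `m_Z` is
monic and does not involve `β_j`. The same formula shows that setting `β_j = 0` turns
`𝖿(Z ∪ {j},τ)` into `𝖿(Z,τ+1)` (`mapCoeff_kill_skewF`).

*Greatest common right divisors.* The least common left multiple of two of the `f_i` is
`𝖿(Z₁ ∪ Z₂, max τ₁ τ₂)`. A dimension count then yields a Bézout relation, over `R_n` up to a nonzero
constant factor, for `𝖿(Z₁ ∩ Z₂, min τ₁ τ₂)`, which is therefore the gcrd (`isGcrd_iff`).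

*Necessity.* All products `g_i f_i` of degree less than `k` are left multiples of the gcrd, and these
have only `k - deg gcrd` free coefficients (`exists_relation`).

*Sufficiency* (`DimCondition.independent`). Induction on `k + |S| + ∑ |Z_i|`, where `S` is the set of
indices. If the inequality is an equality for a proper subset with at least two members, that subset
is replaced by its gcrd. If at most one `τ_i` vanishes, constant coefficients show that every term of
a relation is right divisible by `X`, and `X` is cancelled; as `X w = σ(w) X`, this applies `σ` to
the `f_i`, and the induction therefore treats all Frobenius twists together. Otherwise there are
two indices with `τ_i = 0`, and a point `x` in one of their sets but not in the other; setting
`β_x = 0` moves `x` from the sets to the exponents and preserves the inequalities, which are strict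
where they could be violated. A relation before the specialization gives one after it, once
the common powers of `β_x` have been divided out.
-/

namespace SkewCode

open SkewPolynomial (X C φ monomial)
open Finset.HasAntidiagonal (antidiagonal)

/-! ### Skew polynomials of bounded degree -/

section Degree

variable {R : Type*} [CommRing R]

theorem coeff_sum {ι : Type*} (s : Finset ι) (f : ι → SkewPolynomial R) (n : ℕ) :
    (∑ i ∈ s, f i).coeff n = ∑ i ∈ s, (f i).coeff n :=
  map_sum (AddMonoidHom.mk' (fun p : SkewPolynomial R => p.coeff n)
    fun _ _ => SkewPolynomial.coeff_add _ _ _) f s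

theorem coeff_smul (c : R) (f : SkewPolynomial R) (n : ℕ) : (c • f).coeff n = c * f.coeff n := rfl

/-- The skew polynomials of degree less than `n`. -/
def degreeLT (R : Type*) [CommRing R] (n : ℕ) : Submodule R (SkewPolynomial R) where
  carrier := {f | ∀ m, n ≤ m → f.coeff m = 0}
  add_mem' hf hg m hm := by rw [SkewPolynomial.coeff_add, hf m hm, hg m hm, add_zero]
  zero_mem' _ _ := rfl
  smul_mem' c f hf m hm := by
    change c * f.coeff m = 0
    rw [hf m hm, mul_zero]

theorem degreeLT_mono {m n : ℕ} (h : m ≤ n) : degreeLT R m ≤ degreeLT R n :=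
  fun _ hf i hi => hf i (h.trans hi)

theorem eq_zero_of_mem_degreeLT_zero {f : SkewPolynomial R} (hf : f ∈ degreeLT R 0) : f = 0 := by
  ext n
  exact hf n (Nat.zero_le n)

theorem exists_mem_degreeLT (f : SkewPolynomial R) : ∃ n, f ∈ degreeLT R n := by
  refine ⟨f.support.sup id + 1, fun m hm => ?_⟩
  by_contra h
  have := Finset.le_sup (f := id) (SkewPolynomial.mem_support_iff.mpr h)
  simp at this
  omega

theorem C_mem_degreeLT (c : R) : C c ∈ degreeLT R 1 := fun m hm =>
  SkewPolynomial.coeff_C_ne_zero (by omega)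

theorem eq_C_of_mem_degreeLT_one {f : SkewPolynomial R} (hf : f ∈ degreeLT R 1) :
    f = C (f.coeff 0) := by
  ext n
  rcases n with _ | n
  · simp
  · rw [hf _ (by omega), SkewPolynomial.coeff_C_succ]

theorem monomial_mem_degreeLT (n : ℕ) (c : R) : monomial n c ∈ degreeLT R (n + 1) := fun m hm => by
  rw [SkewPolynomial.coeff_monomial, if_neg (by omega)]

/-- A skew polynomial as the sum of its monomials. -/
theorem eq_sum_monomial {f : SkewPolynomial R} {n : ℕ} (hf : f ∈ degreeLT R n) :
    f = ∑ i ∈ Finset.range n, monomial i (f.coeff i) := by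
  ext m
  rw [coeff_sum]
  simp only [SkewPolynomial.coeff_monomial, Finset.sum_ite_eq', Finset.mem_range]
  split_ifs with h
  · rfl
  · exact hf m (by omega)

theorem degree_le_iff {f : SkewPolynomial R} {n : ℕ} :
    degree f ≤ n ↔ f ∈ degreeLT R (n + 1) := by
  unfold degree
  rw [Finset.max_le_iff]
  constructor
  · intro h m hm
    by_contra hne
    have := WithBot.coe_le_coe.mp (h m (SkewPolynomial.mem_support_iff.mpr hne))
    simp at this
    omega
  · intro h m hm
    rw [SkewPolynomial.mem_support_iff] at hm
    by_contra hlt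
    refine hm (h m ?_)
    exact Nat.succ_le_of_lt (WithBot.coe_lt_coe.mp (not_le.mp hlt))

/-- `f` is monic of degree `d`. -/
def MonicOfDegree (f : SkewPolynomial R) (d : ℕ) : Prop :=
  f ∈ degreeLT R (d + 1) ∧ f.coeff d = 1

theorem MonicOfDegree.degree_eq [Nontrivial R] {f : SkewPolynomial R} {d : ℕ}
    (hf : MonicOfDegree f d) : degree f = d := by
  refine le_antisymm (degree_le_iff.mpr hf.1) ?_
  exact Finset.le_max (a := d)
    (SkewPolynomial.mem_support_iff.mpr (by rw [hf.2]; exact one_ne_zero))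

theorem MonicOfDegree.natDegree_eq [Nontrivial R] {f : SkewPolynomial R} {d : ℕ}
    (hf : MonicOfDegree f d) : natDegree f = d := by
  rw [natDegree, hf.degree_eq]
  rfl

theorem MonicOfDegree.isMonic [Nontrivial R] {f : SkewPolynomial R} {d : ℕ}
    (hf : MonicOfDegree f d) : IsMonic f := by
  rw [IsMonic, hf.natDegree_eq, hf.2]

theorem IsMonic.monicOfDegree {f : SkewPolynomial R} (hf : IsMonic f) :
    MonicOfDegree f (natDegree f) := by
  refine ⟨?_, hf⟩
  rw [← degree_le_iff]
  unfold natDegree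
  cases degree f with
  | bot => exact bot_le
  | coe a => exact le_rfl

theorem monicOfDegree_one : MonicOfDegree (1 : SkewPolynomial R) 0 :=
  ⟨C_mem_degreeLT 1, SkewPolynomial.coeff_one_zero⟩

theorem monicOfDegree_X_sub_C (c : R) : MonicOfDegree (X - C c : SkewPolynomial R) 1 := by
  refine ⟨Submodule.sub_mem _ (monomial_mem_degreeLT 1 1)
    (degreeLT_mono (by omega) (C_mem_degreeLT c)), ?_⟩
  simp

/-- The skew polynomial of degree less than `n` with prescribed coefficients. -/
noncomputable def ofVec (n : ℕ) (v : Fin n → R) : SkewPolynomial R :=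
  ∑ r : Fin n, monomial (r : ℕ) (v r)

theorem coeff_ofVec {n : ℕ} (v : Fin n → R) (m : ℕ) :
    (ofVec n v).coeff m = if h : m < n then v ⟨m, h⟩ else 0 := by
  rw [ofVec, coeff_sum]
  simp only [SkewPolynomial.coeff_monomial]
  split_ifs with h
  · rw [Finset.sum_eq_single ⟨m, h⟩]
    · simp
    · intro r _ hr
      rw [if_neg]
      rintro rfl
      exact hr rfl
    · simp
  · exact Finset.sum_eq_zero fun r _ => if_neg (by have := r.2; omega)

theorem ofVec_mem_degreeLT {n : ℕ} (v : Fin n → R) : ofVec n v ∈ degreeLT R n := fun m hm => by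
  rw [coeff_ofVec, dif_neg (by omega)]

theorem ofVec_coeff {n : ℕ} {f : SkewPolynomial R} (hf : f ∈ degreeLT R n) :
    ofVec n (fun r => f.coeff r) = f := by
  ext m
  rw [coeff_ofVec]
  split_ifs with h
  · rfl
  · rw [hf m (by omega)]

theorem eq_zero_of_ofVec_eq_zero {n : ℕ} {v : Fin n → R} (h : ofVec n v = 0) : v = 0 := by
  ext r
  have := coeff_ofVec v r
  rwa [h, dif_pos r.2, SkewPolynomial.coeff_zero, eq_comm] at this

theorem ofVec_add {n : ℕ} (v w : Fin n → R) : ofVec n (v + w) = ofVec n v + ofVec n w := by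
  simp [ofVec, Finset.sum_add_distrib]

theorem ofVec_smul {n : ℕ} (c : R) (v : Fin n → R) : ofVec n (c • v) = c • ofVec n v := by
  simp only [ofVec, Finset.smul_sum, SkewPolynomial.smul_monomial]
  rfl

end Degree

/-! ### Coefficients of products -/

section SkewRing

variable {R : Type*} [CommRing R] [MulSemiringAction (Multiplicative ℕ) R]

theorem coeff_mul (f g : SkewPolynomial R) (n : ℕ) :
    (f * g).coeff n =
      ∑ p ∈ antidiagonal n, f.coeff p.1 * φ^[p.1] (g.coeff p.2) := by
  have h := SkewMonoidAlgebra.coeff_mul_antidiagonal_of_finset f g (Multiplicative.ofAdd n)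
    ((antidiagonal n).map (Multiplicative.ofAdd.prodCongr Multiplicative.ofAdd).toEmbedding)
    (by
      rintro ⟨i, j⟩
      simp only [Finset.mem_map_equiv, Finset.HasAntidiagonal.mem_antidiagonal]
      exact Iff.rfl)
  rw [Finset.sum_map] at h
  refine h.trans (Finset.sum_congr rfl fun p _ => ?_)
  rw [SkewPolynomial.φ_iterate_apply]
  rfl

theorem coeff_zero_mul (f g : SkewPolynomial R) : (f * g).coeff 0 = f.coeff 0 * g.coeff 0 := by
  rw [coeff_mul, Finset.HasAntidiagonal.antidiagonal_zero, Finset.sum_singleton]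
  rfl

theorem coeff_C_mul (c : R) (f : SkewPolynomial R) (n : ℕ) :
    (C c * f).coeff n = c * f.coeff n := by
  rw [coeff_mul, Finset.sum_eq_single (0, n)]
  · simp
  · rintro ⟨i, j⟩ h hne
    have : i ≠ 0 := by
      rintro rfl
      simp_all
    simp [SkewPolynomial.coeff_C_ne_zero this]
  · simp

theorem coeff_X_pow_mul (r : ℕ) (f : SkewPolynomial R) (n : ℕ) :
    (X ^ r * f).coeff n = if r ≤ n then φ^[r] (f.coeff (n - r)) else 0 := by
  rw [coeff_mul, SkewPolynomial.X_pow_eq_monomial]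
  split_ifs with h
  · rw [Finset.sum_eq_single (r, n - r)]
    · simp [SkewPolynomial.coeff_monomial]
    · rintro ⟨i, j⟩ hij hne
      have : r ≠ i := by
        rintro rfl
        rw [Finset.HasAntidiagonal.mem_antidiagonal] at hij
        apply hne
        ext <;> simp; omega
      simp [SkewPolynomial.coeff_monomial, this]
    · intro h'
      simp at h'
      omega
  · refine Finset.sum_eq_zero ?_
    rintro ⟨i, j⟩ hij
    rw [Finset.HasAntidiagonal.mem_antidiagonal] at hij
    have : r ≠ i := by simp at hij; omega
    simp [SkewPolynomial.coeff_monomial, this]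

theorem coeff_mul_X_pow (r : ℕ) (f : SkewPolynomial R) (n : ℕ) :
    (f * X ^ r).coeff n = if r ≤ n then f.coeff (n - r) else 0 := by
  rw [coeff_mul, SkewPolynomial.X_pow_eq_monomial]
  split_ifs with h
  · rw [Finset.sum_eq_single (n - r, r)]
    · simp [SkewPolynomial.coeff_monomial, iterate_map_one]
    · rintro ⟨i, j⟩ hij hne
      have : r ≠ j := by
        rintro rfl
        rw [Finset.HasAntidiagonal.mem_antidiagonal] at hij
        apply hne
        ext <;> simp; omega
      simp [SkewPolynomial.coeff_monomial, this, iterate_map_zero]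
    · intro h'
      simp at h'
      omega
  · refine Finset.sum_eq_zero ?_
    rintro ⟨i, j⟩ hij
    rw [Finset.HasAntidiagonal.mem_antidiagonal] at hij
    have : r ≠ j := by simp at hij; omega
    simp [SkewPolynomial.coeff_monomial, this, iterate_map_zero]

theorem C_mul_eq_smul (c : R) (f : SkewPolynomial R) : C c * f = c • f := by
  ext n
  rw [coeff_C_mul, coeff_smul]

theorem X_pow_mul_C (n : ℕ) (c : R) :
    (X : SkewPolynomial R) ^ n * C c = C (φ^[n] c) * X ^ n := by
  rw [SkewPolynomial.X_pow_eq_monomial]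
  simp

theorem mul_mem_degreeLT {f g : SkewPolynomial R} {m n : ℕ} (hf : f ∈ degreeLT R m)
    (hg : g ∈ degreeLT R (n + 1)) : f * g ∈ degreeLT R (m + n) := by
  intro i hi
  rw [coeff_mul]
  refine Finset.sum_eq_zero ?_
  rintro ⟨a, b⟩ hab
  rw [Finset.HasAntidiagonal.mem_antidiagonal] at hab
  simp only at hab ⊢
  rcases Nat.lt_or_ge a m with h | h
  · rw [hg b (by omega), iterate_map_zero, mul_zero]
  · rw [hf a h, zero_mul]

/-! ### Monic skew polynomials and right division -/

theorem monicOfDegree_X_pow (n : ℕ) : MonicOfDegree (X ^ n : SkewPolynomial R) n := by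
  rw [SkewPolynomial.X_pow_eq_monomial]
  exact ⟨monomial_mem_degreeLT n 1, by simp [SkewPolynomial.coeff_monomial]⟩

theorem coeff_mul_of_mem_degreeLT {f g : SkewPolynomial R} {m n : ℕ} (hf : f ∈ degreeLT R (m + 1))
    (hg : g ∈ degreeLT R (n + 1)) : (f * g).coeff (m + n) = f.coeff m * φ^[m] (g.coeff n) := by
  rw [coeff_mul, Finset.sum_eq_single (m, n)]
  · rintro ⟨a, b⟩ hab hne
    rw [Finset.HasAntidiagonal.mem_antidiagonal] at hab
    simp only at hab ⊢
    rcases lt_trichotomy a m with h | h | h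
    · rw [hg b (by omega), iterate_map_zero, mul_zero]
    · exact absurd (Prod.ext h (by simp; omega)) hne
    · rw [hf a (by omega), zero_mul]
  · simp

theorem MonicOfDegree.mul {f g : SkewPolynomial R} {m n : ℕ} (hf : MonicOfDegree f m)
    (hg : MonicOfDegree g n) : MonicOfDegree (f * g) (m + n) := by
  refine ⟨?_, ?_⟩
  · have := mul_mem_degreeLT hf.1 hg.1
    rwa [add_right_comm] at this
  · rw [coeff_mul_of_mem_degreeLT hf.1 hg.1, hf.2, hg.2, iterate_map_one, one_mul]

/-- The degree of a left factor is controlled by the degree of the product with a monic right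
factor. -/
theorem MonicOfDegree.mem_degreeLT_of_mul {f g : SkewPolynomial R} {d n : ℕ}
    (hg : MonicOfDegree g d) (h : f * g ∈ degreeLT R (n + d)) : f ∈ degreeLT R n := by
  obtain ⟨N, hN⟩ := exists_mem_degreeLT f
  induction N with
  | zero => exact degreeLT_mono (Nat.zero_le n) hN
  | succ N ih =>
    rcases Nat.lt_or_ge N n with hlt | hge
    · exact degreeLT_mono hlt hN
    · refine ih fun m hm => ?_
      rcases Nat.eq_or_lt_of_le hm with rfl | hm
      · have h1 := coeff_mul_of_mem_degreeLT hN hg.1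
        rwa [hg.2, iterate_map_one, mul_one, h _ (by omega), eq_comm] at h1
      · exact hN m hm

theorem MonicOfDegree.eq_zero_of_mul_mem {f g : SkewPolynomial R} {d : ℕ}
    (hg : MonicOfDegree g d) (h : f * g ∈ degreeLT R d) : f = 0 :=
  eq_zero_of_mem_degreeLT_zero (hg.mem_degreeLT_of_mul (by rwa [zero_add]))

theorem MonicOfDegree.eq_zero_of_mul {f g : SkewPolynomial R} {d : ℕ}
    (hg : MonicOfDegree g d) (h : f * g = 0) : f = 0 :=
  hg.eq_zero_of_mul_mem (h ▸ Submodule.zero_mem _)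

/-- Right division by a monic skew polynomial. -/
theorem MonicOfDegree.exists_eq_mul_add {g : SkewPolynomial R} {d : ℕ}
    (hg : MonicOfDegree g d) (f : SkewPolynomial R) :
    ∃ h r, r ∈ degreeLT R d ∧ f = h * g + r := by
  obtain ⟨N, hN⟩ := exists_mem_degreeLT f
  induction N generalizing f with
  | zero => exact ⟨0, f, degreeLT_mono (Nat.zero_le d) hN, by simp⟩
  | succ N ih =>
    rcases Nat.lt_or_ge N d with hlt | hge
    · exact ⟨0, f, degreeLT_mono hlt hN, by simp⟩
    · -- subtracting `t * g` removes the leading term of `f`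
      set t : SkewPolynomial R := monomial (N - d) (f.coeff N) with ht
      have ht1 : t ∈ degreeLT R (N - d + 1) := monomial_mem_degreeLT _ _
      obtain ⟨h, r, hr, he⟩ := ih (f - t * g) (by
        intro m hm
        rw [SkewPolynomial.coeff_sub]
        rcases Nat.eq_or_lt_of_le hm with rfl | hm
        · have h1 := coeff_mul_of_mem_degreeLT ht1 hg.1
          rw [Nat.sub_add_cancel hge, hg.2, iterate_map_one, mul_one] at h1
          rw [h1, ht, SkewPolynomial.coeff_monomial, if_pos rfl, sub_self]
        · rw [hN m hm, mul_mem_degreeLT ht1 hg.1 m (by omega), sub_zero])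
      exact ⟨h + t, r, hr, by rw [add_mul, add_right_comm, ← he, sub_add_cancel]⟩

theorem MonicOfDegree.eq_of_rightDvd {f g : SkewPolynomial R} {d : ℕ} (hf : MonicOfDegree f d)
    (hg : MonicOfDegree g d) (h : RightDvd g f) : f = g := by
  obtain ⟨u, rfl⟩ := h
  have hu : u ∈ degreeLT R 1 := hg.mem_degreeLT_of_mul (by rw [add_comm]; exact hf.1)
  have h1 := coeff_mul_of_mem_degreeLT (m := 0) hu hg.1
  rw [zero_add, hf.2, hg.2, iterate_map_one, mul_one] at h1
  rw [eq_C_of_mem_degreeLT_one hu, ← h1, SkewPolynomial.C_1, one_mul]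

theorem RightDvd.trans {f g h : SkewPolynomial R} (h1 : RightDvd f g) (h2 : RightDvd g h) :
    RightDvd f h := by
  obtain ⟨u, rfl⟩ := h1
  obtain ⟨v, rfl⟩ := h2
  exact ⟨v * u, by rw [mul_assoc]⟩

theorem exists_eq_mul_X_pow {f : SkewPolynomial R} {n : ℕ} (h : ∀ i < n, f.coeff i = 0) :
    RightDvd (X ^ n) f := by
  obtain ⟨u, r, hr, he⟩ := (monicOfDegree_X_pow (R := R) n).exists_eq_mul_add f
  refine ⟨u, ?_⟩
  have : r = 0 := by
    ext i
    rcases Nat.lt_or_ge i n with hi | hi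
    · have h1 := h i hi
      rw [he, SkewPolynomial.coeff_add, coeff_mul_X_pow, if_neg (by omega), zero_add] at h1
      exact h1
    · exact hr i hi
  rw [he, this, add_zero]

end SkewRing

/-! ### Endomorphisms acting on the coefficients -/

section CoefficientMaps

variable {R : Type*} [CommRing R] [MulSemiringAction (Multiplicative ℕ) R]

/-- The ring endomorphism of `R[X;φ]` that applies to each coefficient an endomorphism `θ` of `R`
commuting with `φ`. -/
noncomputable def mapCoeff (θ : R →+* R) (h : ∀ x, θ (φ x) = φ (θ x)) :
    SkewPolynomial R →+* SkewPolynomial R :=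
  SkewMonoidAlgebra.liftNCRingHom (SkewPolynomial.CRingHom.comp θ) (powersHom _ X) (by
    intro x y
    have hy : y • x = φ^[y.toAdd] x := by
      rw [SkewPolynomial.φ_iterate_apply]
      rfl
    have hc : Function.Commute θ (φ : R →+* R) := h
    rw [hy]
    simp only [RingHom.comp_apply, SkewPolynomial.CRingHom_eq_C, powersHom_apply, X_pow_mul_C,
      (hc.iterate_right _).eq])

theorem mapCoeff_monomial (θ : R →+* R) (h : ∀ x, θ (φ x) = φ (θ x)) (n : ℕ) (c : R) :
    mapCoeff θ h (monomial n c) = monomial n (θ c) := by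
  have h1 : mapCoeff θ h (monomial n c) = C (θ c) * X ^ n :=
    SkewMonoidAlgebra.liftNC_single _ _ _ _
  rw [h1, SkewPolynomial.X_pow_eq_monomial]
  simp

theorem coeff_mapCoeff (θ : R →+* R) (h : ∀ x, θ (φ x) = φ (θ x)) (f : SkewPolynomial R)
    (n : ℕ) : (mapCoeff θ h f).coeff n = θ (f.coeff n) := by
  induction f using SkewPolynomial.induction with
  | h0 => simp
  | ha m r q _ _ ih =>
    rw [map_add, SkewPolynomial.coeff_add, ih, mapCoeff_monomial, SkewPolynomial.coeff_add,
      map_add, SkewPolynomial.coeff_monomial, SkewPolynomial.coeff_monomial, apply_ite θ, map_zero]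

theorem mapCoeff_mem_degreeLT (θ : R →+* R) (h : ∀ x, θ (φ x) = φ (θ x)) {f : SkewPolynomial R}
    {n : ℕ} (hf : f ∈ degreeLT R n) : mapCoeff θ h f ∈ degreeLT R n := fun m hm => by
  rw [coeff_mapCoeff, hf m hm, map_zero]

theorem MonicOfDegree.mapCoeff {f : SkewPolynomial R} {d : ℕ} (hf : MonicOfDegree f d)
    (θ : R →+* R) (h : ∀ x, θ (φ x) = φ (θ x)) : MonicOfDegree (mapCoeff θ h f) d :=
  ⟨mapCoeff_mem_degreeLT θ h hf.1, by rw [coeff_mapCoeff, hf.2, map_one]⟩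

theorem mapCoeff_C (θ : R →+* R) (h : ∀ x, θ (φ x) = φ (θ x)) (c : R) :
    mapCoeff θ h (C c) = C (θ c) :=
  mapCoeff_monomial θ h 0 c

theorem mapCoeff_X (θ : R →+* R) (h : ∀ x, θ (φ x) = φ (θ x)) : mapCoeff θ h X = X := by
  rw [SkewPolynomial.X, mapCoeff_monomial, map_one]

/-- The endomorphism of `R[X;φ]` that applies `φ^e` to each coefficient; it describes how
powers of `X` move past a skew polynomial. -/
noncomputable def twist (e : ℕ) : SkewPolynomial R →+* SkewPolynomial R :=
  mapCoeff ((φ : R →+* R) ^ e) (fun x => by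
    rw [RingHom.coe_pow, ← Function.iterate_succ_apply, Function.iterate_succ_apply'])

theorem coeff_twist (e : ℕ) (f : SkewPolynomial R) (n : ℕ) :
    (twist e f).coeff n = φ^[e] (f.coeff n) := by
  rw [twist, coeff_mapCoeff, RingHom.coe_pow]

theorem twist_zero (f : SkewPolynomial R) : twist 0 f = f := by
  ext n
  rw [coeff_twist, Function.iterate_zero_apply]

theorem twist_X (e : ℕ) : twist e (X : SkewPolynomial R) = X :=
  mapCoeff_X _ _

theorem X_pow_mul_eq_twist (n : ℕ) (f : SkewPolynomial R) : X ^ n * f = twist n f * X ^ n := by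
  ext m
  rw [coeff_X_pow_mul, coeff_mul_X_pow]
  simp only [coeff_twist]

theorem X_mul_twist (e : ℕ) (f : SkewPolynomial R) :
    X * twist e f = twist (e + 1) f * X := by
  ext m
  have h1 := coeff_X_pow_mul 1 (twist e f) m
  have h2 := coeff_mul_X_pow 1 (twist (e + 1) f) m
  rw [pow_one] at h1 h2
  rw [h1, h2]
  simp only [coeff_twist, Function.iterate_succ_apply',
    Function.iterate_zero, id]

theorem twist_mapCoeff (e : ℕ) (θ : R →+* R) (h : ∀ x, θ (φ x) = φ (θ x))
    (f : SkewPolynomial R) : twist e (mapCoeff θ h f) = mapCoeff θ h (twist e f) := by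
  have hc : Function.Commute θ (φ : R →+* R) := h
  ext n
  rw [coeff_twist, coeff_mapCoeff, coeff_mapCoeff, coeff_twist, (hc.iterate_right e).eq]

/-! ### Evaluation on the coefficient ring -/

/-- The `φ`-semilinear map `b ↦ a φ(b)`. -/
noncomputable def semilinearMul (a : R) : AddMonoid.End R :=
  (AddMonoidHom.mulLeft a).comp (φ : R →+* R).toAddMonoidHom

/-- The action of `R[X;φ]` on `R` in which `X` acts as `b ↦ a φ(b)`. The skew polynomial
`X - C γ` annihilates every `b` with `a φ(b) = γ b`. -/
noncomputable def evalHom (a : R) : SkewPolynomial R →+* AddMonoid.End R :=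
  SkewMonoidAlgebra.liftNCRingHom (Module.toAddMonoidEnd R R)
    (powersHom _ (semilinearMul a)) (by
      intro x y
      have hy : y • x = φ^[y.toAdd] x := by
        rw [SkewPolynomial.φ_iterate_apply]
        rfl
      rw [hy, powersHom_apply]
      induction y.toAdd with
      | zero => ext b; simp
      | succ n ih =>
        ext b
        have h1 : φ^[n] x * (semilinearMul a ^ n) b = (semilinearMul a ^ n) (x * b) :=
          DFunLike.congr_fun ih b
        rw [pow_succ']
        change φ^[n + 1] x * (a * φ ((semilinearMul a ^ n) b)) =
          a * φ ((semilinearMul a ^ n) (x * b))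
        rw [← h1, map_mul, Function.iterate_succ_apply']
        ring)

theorem evalHom_monomial (a : R) (n : ℕ) (c b : R) :
    evalHom a (monomial n c) b = c * (semilinearMul a ^ n) b := by
  have h1 : evalHom a (monomial n c) =
      Module.toAddMonoidEnd R R c * powersHom _ (semilinearMul a) (Multiplicative.ofAdd n) :=
    SkewMonoidAlgebra.liftNC_single _ _ _ _
  rw [h1]
  rfl

theorem evalHom_C (a c b : R) : evalHom a (C c) b = c * b := by
  rw [← SkewPolynomial.monomial_zero_left, evalHom_monomial]
  simp

theorem evalHom_X (a b : R) : evalHom a X b = a * φ b := by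
  rw [SkewPolynomial.X, evalHom_monomial, pow_one, one_mul]
  rfl

theorem evalHom_mul (a : R) (f g : SkewPolynomial R) (b : R) :
    evalHom a (f * g) b = evalHom a f (evalHom a g b) := by
  rw [map_mul]
  rfl

theorem evalHom_add (a : R) (f g : SkewPolynomial R) (b : R) :
    evalHom a (f + g) b = evalHom a f b + evalHom a g b := by
  rw [map_add]
  rfl

theorem semilinearMul_pow_succ (a b : R) (n : ℕ) :
    (semilinearMul a ^ (n + 1)) b = a * φ ((semilinearMul a ^ n) b) := by
  rw [pow_succ']
  rfl

theorem semilinearMul_pow_map (θ : R →+* R) (h : ∀ x, θ (φ x) = φ (θ x)) (a b : R) (n : ℕ) :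
    θ ((semilinearMul a ^ n) b) = (semilinearMul (θ a) ^ n) (θ b) := by
  induction n with
  | zero => simp
  | succ n ih =>
    rw [semilinearMul_pow_succ, semilinearMul_pow_succ, ← ih, map_mul, h]

theorem evalHom_mapCoeff (θ : R →+* R) (h : ∀ x, θ (φ x) = φ (θ x)) (a : R)
    (f : SkewPolynomial R) (b : R) :
    evalHom (θ a) (mapCoeff θ h f) (θ b) = θ (evalHom a f b) := by
  induction f using SkewPolynomial.induction with
  | h0 => simp
  | ha m r q _ _ ih =>
    rw [map_add, evalHom_add, evalHom_add, ih, mapCoeff_monomial, evalHom_monomial, evalHom_monomial, map_add, map_mul,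
      semilinearMul_pow_map θ h]

theorem evalHom_eq_sum (a : R) {f : SkewPolynomial R} {n : ℕ} (hf : f ∈ degreeLT R n) (b : R) :
    evalHom a f b = ∑ i ∈ Finset.range n, f.coeff i * (semilinearMul a ^ i) b := by
  conv_lhs => rw [eq_sum_monomial hf]
  rw [map_sum]
  refine (AddMonoidHom.finsetSum_apply _ _ b).trans (Finset.sum_congr rfl fun i _ => ?_)
  exact evalHom_monomial _ _ _ _

/-- The skew polynomials that annihilate a nonzero `b` are the left multiples of the linear one. -/
theorem rightDvd_X_sub_C_iff [IsDomain R] {a b γ : R} (hb : b ≠ 0) (hγ : a * φ b = γ * b)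
    (f : SkewPolynomial R) : RightDvd (X - C γ) f ↔ evalHom a f b = 0 := by
  have h0 : evalHom a (X - C γ) b = 0 := by
    have h1 := evalHom_add a (X - C γ) (C γ) b
    rw [sub_add_cancel, evalHom_X, evalHom_C, hγ] at h1
    exact left_eq_add.mp (h1.trans (add_comm _ _))
  constructor
  · rintro ⟨u, rfl⟩
    rw [evalHom_mul, h0, map_zero]
  · intro hf
    obtain ⟨u, r, hr, rfl⟩ := (monicOfDegree_X_sub_C γ).exists_eq_mul_add f
    rw [evalHom_add, evalHom_mul, h0, map_zero, zero_add,
      eq_C_of_mem_degreeLT_one hr, evalHom_C, mul_eq_zero, or_iff_left hb] at hf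
    refine ⟨u, ?_⟩
    rw [eq_C_of_mem_degreeLT_one hr, hf, map_zero, add_zero]

/-! ### Relations from dimension counts -/

/-- If the products `g_i f_i` of degree less than `N` have more free coefficients altogether than
the left multiples of degree less than `N` of a common right divisor `D`, then the `f_i` satisfy
a nontrivial relation. -/
theorem exists_relation [Nontrivial R] {ι : Type*} (S : Finset ι) (f : ι → SkewPolynomial R)
    (d n : ι → ℕ) {N e : ℕ} {D : SkewPolynomial R} (hD : MonicOfDegree D e)
    (hf : ∀ i ∈ S, MonicOfDegree (f i) (d i)) (hdvd : ∀ i ∈ S, RightDvd D (f i))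
    (hn : ∀ i ∈ S, n i + d i ≤ N) (he : e ≤ N) (hN : N < ∑ i ∈ S, n i + e) :
    ∃ g : ι → SkewPolynomial R, (∀ i ∈ S, g i ∈ degreeLT R (n i)) ∧
      (∃ i ∈ S, g i ≠ 0) ∧ ∑ i ∈ S, g i * f i = 0 := by
  classical
  choose! h hh using hdvd
  -- writing `f_i = h_i * D`, the map `Φ` sends the coefficients of the `g_i` to those of `∑ g_i h_i`;
  -- in degrees at least `N - e` the latter vanish for reasons of degree
  let Φ : ((Σ i : S, Fin (n i)) → R) →ₗ[R] (Fin (N - e) → R) :=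
    { toFun := fun v c => (∑ i : S, ofVec (n i) (fun r => v ⟨i, r⟩) * h i).coeff c
      map_add' := by
        intro v w
        ext c
        have : ∀ i : S, ofVec (n i) (fun r => (v + w) ⟨i, r⟩) =
          ofVec (n i) (fun r => v ⟨i, r⟩) + ofVec (n i) (fun r => w ⟨i, r⟩) :=
          fun i => ofVec_add _ _
        change (∑ i : S, ofVec (n i) (fun r => (v + w) ⟨i, r⟩) * h i).coeff c = _
        simp only [this, add_mul, Finset.sum_add_distrib, SkewPolynomial.coeff_add]
        rfl
      map_smul' := by
        intro a v
        ext c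
        have : ∀ i : S, ofVec (n i) (fun r => (a • v) ⟨i, r⟩) =
          a • ofVec (n i) (fun r => v ⟨i, r⟩) := fun i => ofVec_smul _ _
        change (∑ i : S, ofVec (n i) (fun r => (a • v) ⟨i, r⟩) * h i).coeff c = _
        simp only [this, smul_mul_assoc, ← Finset.smul_sum]
        rfl }
  have hΦ : ¬ Function.Injective Φ := by
    intro hinj
    have := card_le_of_injective R Φ hinj
    rw [Fintype.card_sigma, Fintype.card_fin] at this
    simp only [Fintype.card_fin] at this
    rw [Finset.sum_coe_sort S n] at this
    omega
  rw [← LinearMap.ker_eq_bot, Submodule.eq_bot_iff] at hΦ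
  push Not at hΦ
  obtain ⟨v, hv, hv0⟩ := hΦ
  refine ⟨fun i => if hi : i ∈ S then ofVec (n i) (fun r => v ⟨⟨i, hi⟩, r⟩) else 0, ?_, ?_, ?_⟩
  · intro i hi
    simp only [dif_pos hi]
    exact ofVec_mem_degreeLT _
  · by_contra hcon
    push Not at hcon
    apply hv0
    ext ⟨⟨i, hi⟩, r⟩
    have := hcon i hi
    rw [dif_pos hi] at this
    exact congr_fun (eq_zero_of_ofVec_eq_zero this) r
  · have hsum : ∑ i ∈ S, (if hi : i ∈ S then ofVec (n i) (fun r => v ⟨⟨i, hi⟩, r⟩) else 0) * f i =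
        (∑ i : S, ofVec (n i) (fun r => v ⟨i, r⟩) * h i) * D := by
      rw [← Finset.sum_coe_sort, Finset.sum_mul]
      refine Finset.sum_congr rfl fun i _ => ?_
      rw [dif_pos i.2, mul_assoc, ← hh i i.2]
    rw [hsum]
    have hmem : (∑ i : S, ofVec (n i) (fun r => v ⟨i, r⟩) * h i) ∈ degreeLT R (N - e) := by
      refine hD.mem_degreeLT_of_mul ?_
      rw [Nat.sub_add_cancel he, Finset.sum_mul]
      refine Submodule.sum_mem _ fun i _ => ?_
      rw [mul_assoc, ← hh i i.2]
      exact degreeLT_mono (hn i i.2) (mul_mem_degreeLT (ofVec_mem_degreeLT _) (hf i i.2).1)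
    have hzero : (∑ i : S, ofVec (n i) (fun r => v ⟨i, r⟩) * h i) = 0 := by
      ext m
      rcases Nat.lt_or_ge m (N - e) with hm | hm
      · exact congr_fun hv ⟨m, hm⟩
      · exact hmem m hm
    rw [hzero, zero_mul]

/-- A monic right divisor of a nonzero constant multiple of `f` right divides `f`. -/
theorem MonicOfDegree.rightDvd_of_C_mul [IsDomain R] {h f : SkewPolynomial R} {d : ℕ}
    (hh : MonicOfDegree h d) {c : R} (hc : c ≠ 0) (H : RightDvd h (C c * f)) : RightDvd h f := by
  obtain ⟨q, r, hr, rfl⟩ := hh.exists_eq_mul_add f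
  obtain ⟨w, hw⟩ := H
  have h1 : (w - C c * q) * h = C c * r := by
    rw [sub_mul, ← hw, mul_add, mul_assoc, add_sub_cancel_left]
  have h2 : C c * r ∈ degreeLT R d := by
    rw [C_mul_eq_smul]
    exact Submodule.smul_mem _ c hr
  have h3 : C c * r = 0 := by
    have h5 : (w - C c * q) * h ∈ degreeLT R d := by rwa [h1]
    rw [← h1, hh.eq_zero_of_mul_mem h5, zero_mul]
  have h4 : r = 0 := by
    ext n
    have := coeff_C_mul c r n
    rw [h3, SkewPolynomial.coeff_zero, eq_comm, mul_eq_zero, or_iff_right hc] at this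
    exact this
  exact ⟨q, by rw [h4, add_zero]⟩

end CoefficientMaps

/-! ### The coefficient ring and its variables -/

section MinimalPolynomials

variable {F K : Type*} [Field F] [Fintype F] [Field K] [Algebra F K] {ℓ : ℕ} {nl : Fin ℓ → ℕ}

instance : IsDomain (Rn F K nl) :=
  inferInstanceAs (IsDomain (MvPolynomial (Σ l : Fin ℓ, Fin (nl l)) K))

theorem phi_apply (x : Rn F K nl) : φ x = x ^ Fintype.card F := by
  rw [phi_eq_sigma, sigma_apply]

theorem phi_injective : Function.Injective (φ : Rn F K nl →+* Rn F K nl) := by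
  rw [injective_iff_map_eq_zero]
  intro x hx
  rw [phi_apply] at hx
  exact eq_zero_of_pow_eq_zero hx

theorem map_phi {S : Type*} [CommRing S] (θ : Rn F K nl →+* S) (x : Rn F K nl) :
    θ (φ x) = θ x ^ Fintype.card F := by
  rw [phi_apply, map_pow]

/-- The variable `β_{l,t}` with number `j`. -/
noncomputable def pt (F K : Type*) [Field F] [Fintype F] [Field K] [Algebra F K]
    {ℓ : ℕ} {nl : Fin ℓ → ℕ} (j : Fin (∑ l, nl l)) : Rn F K nl :=
  beta F K nl (finSigmaFinEquiv.symm j)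

/-- The representative `a_l` of the conjugacy class that the variable with number `j` belongs to. -/
noncomputable def cls (F : Type*) {K : Type*} [Field F] [Fintype F] [Field K] [Algebra F K]
    {ℓ : ℕ} {nl : Fin ℓ → ℕ} (a : Fin ℓ → K) (j : Fin (∑ l, nl l)) : Rn F K nl :=
  const F nl (a (finSigmaFinEquiv.symm j).1)

theorem pt_ne_zero (j : Fin (∑ l, nl l)) : pt F K j ≠ 0 := MvPolynomial.X_ne_zero _

theorem const_ne_zero {c : K} (hc : c ≠ 0) : const F nl c ≠ 0 :=
  (MvPolynomial.C_ne_zero).mpr hc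

theorem cls_ne_zero {a : Fin ℓ → K} (ha : ∀ l, a l ≠ 0) (j : Fin (∑ l, nl l)) :
    cls F a j ≠ 0 := const_ne_zero (ha _)

theorem cls_mul_phi (a : Fin ℓ → K) (j : Fin (∑ l, nl l)) (G : Rn F K nl) :
    cls F a j * φ G = cls F a j * G ^ (Fintype.card F - 1) * G := by
  rw [phi_apply, mul_assoc, ← pow_succ, Nat.sub_add_cancel Fintype.card_pos]

/-! ### Setting a variable to zero -/

/-- The specialization of `R_n` that sends the variable with number `j` to `0`. -/
noncomputable def kill (j : Fin (∑ l, nl l)) : Rn F K nl →+* Rn F K nl :=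
  MvPolynomial.eval₂Hom (MvPolynomial.C : K →+* MvPolynomial (Σ l : Fin ℓ, Fin (nl l)) K)
    (fun p => if p = finSigmaFinEquiv.symm j then 0 else MvPolynomial.X p)

theorem kill_const (j : Fin (∑ l, nl l)) (c : K) :
    kill j (const F nl c) = const F nl c :=
  MvPolynomial.eval₂_C _ _ _

theorem kill_cls (a : Fin ℓ → K) (i j : Fin (∑ l, nl l)) :
    kill j (cls F a i) = cls F a i :=
  kill_const _ _

theorem kill_pt (i j : Fin (∑ l, nl l)) :
    kill j (pt F K i) = if i = j then 0 else pt F K i := by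
  have h : kill j (pt F K i) = if finSigmaFinEquiv.symm i = finSigmaFinEquiv.symm j then 0
      else pt F K i := MvPolynomial.eval₂_X _ _ _
  rw [h]
  simp only [EmbeddingLike.apply_eq_iff_eq]

theorem kill_phi (j : Fin (∑ l, nl l)) (x : Rn F K nl) : kill j (φ x) = φ (kill j x) := by
  rw [map_phi, phi_apply]

theorem hom_ext {S : Type*} [CommRing S] {f g : Rn F K nl →+* S}
    (hC : ∀ c, f (const F nl c) = g (const F nl c)) (hX : ∀ j, f (pt F K j) = g (pt F K j)) :
    f = g :=
  MvPolynomial.ringHom_ext hC fun p => by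
    have := hX (finSigmaFinEquiv p)
    rwa [pt, Equiv.symm_apply_apply] at this

/-- The kernel of the specialization is generated by the variable that is set to zero. -/
theorem pt_dvd_of_kill_eq_zero {j : Fin (∑ l, nl l)} {x : Rn F K nl} (hx : kill j x = 0) :
    pt F K j ∣ x := by
  have h : (Ideal.Quotient.mk (Ideal.span {pt F K j})).comp (kill j) =
      Ideal.Quotient.mk (Ideal.span {pt F K j}) := by
    refine hom_ext (fun c => ?_) (fun i => ?_)
    · rw [RingHom.comp_apply, kill_const]
    · rw [RingHom.comp_apply, kill_pt]
      split_ifs with hij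
      · rw [map_zero, eq_comm, Ideal.Quotient.eq_zero_iff_mem, hij]
        exact Ideal.mem_span_singleton_self _
      · rfl
  have h1 := RingHom.congr_fun h x
  rw [RingHom.comp_apply, hx, map_zero, eq_comm, Ideal.Quotient.eq_zero_iff_mem,
    Ideal.mem_span_singleton] at h1
  exact h1

/-- An element of `R_n` that is divisible by every power of a variable vanishes. -/
theorem eq_zero_of_forall_pow_dvd {j : Fin (∑ l, nl l)} {x : Rn F K nl}
    (h : ∀ N, pt F K j ^ N ∣ x) : x = 0 := by
  by_contra hx
  have hu : ¬ IsUnit (pt F K j) := fun hu => by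
    have h1 := hu.map (kill (F := F) (K := K) j)
    rw [kill_pt, if_pos rfl] at h1
    exact not_isUnit_zero h1
  have : WfDvdMonoid (Rn F K nl) :=
    inferInstanceAs (WfDvdMonoid (MvPolynomial (Σ l : Fin ℓ, Fin (nl l)) K))
  obtain ⟨N, hN⟩ := FiniteMultiplicity.of_not_isUnit hu hx
  exact hN (h _)

/-- `R_n` as polynomials in the variable with number `j`. -/
noncomputable def toPoly (j : Fin (∑ l, nl l)) : Rn F K nl →+* Polynomial (Rn F K nl) :=
  MvPolynomial.eval₂Hom
    ((Polynomial.C : Rn F K nl →+* _).comp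
      (MvPolynomial.C : K →+* MvPolynomial (Σ l : Fin ℓ, Fin (nl l)) K))
    (fun p => if p = finSigmaFinEquiv.symm j then Polynomial.X else Polynomial.C (beta F K nl p))

theorem toPoly_const (j : Fin (∑ l, nl l)) (c : K) :
    toPoly j (const F nl c) = Polynomial.C (const F nl c) :=
  MvPolynomial.eval₂_C _ _ _

theorem toPoly_pt (i j : Fin (∑ l, nl l)) :
    toPoly j (pt F K i) = if i = j then Polynomial.X else Polynomial.C (pt F K i) := by
  have h : toPoly j (pt F K i) = if finSigmaFinEquiv.symm i = finSigmaFinEquiv.symm j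
      then Polynomial.X else Polynomial.C (pt F K i) := MvPolynomial.eval₂_X _ _ _
  rw [h]
  simp only [EmbeddingLike.apply_eq_iff_eq]

theorem toPoly_kill (j : Fin (∑ l, nl l)) (x : Rn F K nl) :
    toPoly j (kill j x) = Polynomial.C (kill j x) := by
  have h : (toPoly j).comp (kill j) = (Polynomial.C : Rn F K nl →+* _).comp (kill j) := by
    refine hom_ext (fun c => ?_) (fun i => ?_)
    · rw [RingHom.comp_apply, RingHom.comp_apply, kill_const, toPoly_const]
    · rw [RingHom.comp_apply, RingHom.comp_apply, kill_pt]
      split_ifs with hij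
      · rw [map_zero, map_zero]
      · rw [toPoly_pt, if_neg hij]
  exact RingHom.congr_fun h x

/-! ### Minimal skew polynomials of sets of locators -/

/-- `m` is monic of degree `|Z|`, and its left multiples are the skew polynomials that annihilate
`β_j` for all `j ∈ Z`. -/
def IsMinPoly (a : Fin ℓ → K) (Z : Finset (Fin (∑ l, nl l))) (m : SkewPolynomial (Rn F K nl)) :
    Prop :=
  MonicOfDegree m Z.card ∧
    ∀ f, RightDvd m f ↔ ∀ j ∈ Z, evalHom (cls F a j) f (pt F K j) = 0

theorem IsMinPoly.evalHom_eq_zero {a : Fin ℓ → K} {Z : Finset (Fin (∑ l, nl l))}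
    {m : SkewPolynomial (Rn F K nl)} (hm : IsMinPoly a Z m) {j : Fin (∑ l, nl l)} (hj : j ∈ Z) :
    evalHom (cls F a j) m (pt F K j) = 0 :=
  (hm.2 m).mp ⟨1, (one_mul m).symm⟩ j hj

theorem IsMinPoly.unique {a : Fin ℓ → K} {Z : Finset (Fin (∑ l, nl l))}
    {m m' : SkewPolynomial (Rn F K nl)} (hm : IsMinPoly a Z m) (hm' : IsMinPoly a Z m') :
    m = m' :=
  hm.1.eq_of_rightDvd hm'.1 ((hm'.2 m).mpr fun _ hj => hm.evalHom_eq_zero hj)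

theorem rightDvd_locator_iff (a : Fin ℓ → K) (j : Fin (∑ l, nl l))
    (f : SkewPolynomial (Rn F K nl)) :
    RightDvd (X - C (locator F a j)) f ↔ evalHom (cls F a j) f (pt F K j) = 0 :=
  rightDvd_X_sub_C_iff (pt_ne_zero j) (cls_mul_phi a j _) f

/-- A minimal skew polynomial does not involve the variables outside its index set. -/
theorem IsMinPoly.mapCoeff_kill {a : Fin ℓ → K} {Z : Finset (Fin (∑ l, nl l))}
    {m : SkewPolynomial (Rn F K nl)} (hm : IsMinPoly a Z m) {j : Fin (∑ l, nl l)} (hj : j ∉ Z) :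
    mapCoeff (kill j) (kill_phi j) m = m := by
  refine (hm.1.mapCoeff _ _).eq_of_rightDvd hm.1 ((hm.2 _).mpr fun i hi => ?_)
  have h := evalHom_mapCoeff (kill j) (kill_phi j) (cls F a i) m (pt F K i)
  have hij : i ≠ j := fun h => hj (h ▸ hi)
  rwa [kill_cls, kill_pt, if_neg hij, hm.evalHom_eq_zero hi, map_zero] at h

theorem semilinearMul_const_pow {c : K} (hc : c ≠ 0) (n : ℕ) (b : Rn F K nl) :
    ∃ e : K, e ≠ 0 ∧
      (semilinearMul (const F nl c) ^ n) b = const F nl e * b ^ Fintype.card F ^ n := by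
  induction n with
  | zero =>
    refine ⟨1, one_ne_zero, ?_⟩
    have h1 : const F nl (1 : K) = 1 := MvPolynomial.C_1
    rw [h1, pow_zero, pow_zero, pow_one, one_mul]
    rfl
  | succ n ih =>
    obtain ⟨e, he, h⟩ := ih
    refine ⟨c * e ^ Fintype.card F, mul_ne_zero hc (pow_ne_zero _ he), ?_⟩
    have h1 : const F nl (c * e ^ Fintype.card F) =
        const F nl c * const F nl e ^ Fintype.card F := by
      simp only [const, map_mul, map_pow]
      rfl
    rw [semilinearMul_pow_succ, h, phi_apply, mul_pow, h1, mul_assoc, ← pow_mul, ← pow_succ]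

/-- As a polynomial in `β_j`, the value at `β_j` of a monic skew polynomial of degree `d` not
involving `β_j` has degree `q^d`. -/
theorem IsMinPoly.evalHom_ne_zero {a : Fin ℓ → K} (ha : ∀ l, a l ≠ 0)
    {Z : Finset (Fin (∑ l, nl l))} {m : SkewPolynomial (Rn F K nl)} (hm : IsMinPoly a Z m)
    {j : Fin (∑ l, nl l)} (hj : j ∉ Z) : evalHom (cls F a j) m (pt F K j) ≠ 0 := by
  intro h0
  have hc : ∀ i, toPoly j (m.coeff i) = Polynomial.C (m.coeff i) := fun i => by
    have := coeff_mapCoeff (kill j) (kill_phi j) m i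
    rw [hm.mapCoeff_kill hj] at this
    rw [this, toPoly_kill]
  choose e he0 he using fun n => semilinearMul_const_pow (F := F) (nl := nl)
    (ha (finSigmaFinEquiv.symm j).1) n (pt F K j)
  rw [evalHom_eq_sum _ hm.1.1] at h0
  -- compare coefficients at `β_j ^ (q ^ |Z|)`, to which only the leading term of `m` contributes
  have h1 := congr_arg (fun p => (toPoly j p).coeff (Fintype.card F ^ Z.card)) h0
  simp only [map_sum, map_zero, Polynomial.coeff_zero, Polynomial.finsetSum_coeff, map_mul, hc,
    cls, he, toPoly_const, map_pow, toPoly_pt, if_true, Polynomial.coeff_C_mul,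
    Polynomial.coeff_X_pow] at h1
  rw [Finset.sum_eq_single Z.card] at h1
  · rw [if_pos rfl, mul_one, hm.1.2, one_mul] at h1
    exact const_ne_zero (he0 _) h1
  · intro i _ hi
    rw [if_neg, mul_zero, mul_zero]
    exact fun h => hi (Nat.pow_right_injective Fintype.one_lt_card h).symm
  · simp

theorem isMinPoly_empty (a : Fin ℓ → K) : IsMinPoly (nl := nl) (F := F) a ∅ 1 :=
  ⟨monicOfDegree_one, fun f => ⟨fun _ _ h => absurd h (Finset.notMem_empty _),
    fun _ => ⟨f, (mul_one f).symm⟩⟩⟩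

/-- Adjoining a locator multiplies the minimal skew polynomial `m` by the linear skew polynomial
that annihilates the value of `m` at the new variable. -/
theorem IsMinPoly.insert {a : Fin ℓ → K} (ha : ∀ l, a l ≠ 0)
    {Z : Finset (Fin (∑ l, nl l))} {m : SkewPolynomial (Rn F K nl)} (hm : IsMinPoly a Z m)
    {j : Fin (∑ l, nl l)} (hj : j ∉ Z) :
    IsMinPoly a (insert j Z) ((X - C (cls F a j *
      evalHom (cls F a j) m (pt F K j) ^ (Fintype.card F - 1))) * m) := by
  have hG := rightDvd_X_sub_C_iff (hm.evalHom_ne_zero ha hj) (cls_mul_phi a j _)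
  refine ⟨?_, fun f => ?_⟩
  · rw [Finset.card_insert_of_notMem hj, add_comm]
    exact (monicOfDegree_X_sub_C _).mul hm.1
  · rw [Finset.forall_mem_insert, ← hm.2 f]
    constructor
    · rintro ⟨u, rfl⟩
      refine ⟨?_, ⟨u * _, (mul_assoc _ _ _).symm⟩⟩
      rw [← mul_assoc, evalHom_mul]
      exact (hG _).mp ⟨u, rfl⟩
    · rintro ⟨h1, u, rfl⟩
      rw [evalHom_mul] at h1
      obtain ⟨v, rfl⟩ := (hG u).mpr h1
      exact ⟨v, mul_assoc _ _ _⟩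

theorem exists_isMinPoly {a : Fin ℓ → K} (ha : ∀ l, a l ≠ 0) (Z : Finset (Fin (∑ l, nl l))) :
    ∃ m : SkewPolynomial (Rn F K nl), IsMinPoly a Z m := by
  induction Z using Finset.induction_on with
  | empty => exact ⟨1, isMinPoly_empty a⟩
  | insert j Z hj ih =>
    obtain ⟨m, hm⟩ := ih
    exact ⟨_, hm.insert ha hj⟩

theorem isLclm_iff_isMinPoly {a : Fin ℓ → K} (ha : ∀ l, a l ≠ 0) (Z : Finset (Fin (∑ l, nl l)))
    (m : SkewPolynomial (Rn F K nl)) : IsLclm (linearFactors F a Z) m ↔ IsMinPoly a Z m := by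
  have hdvd : ∀ f : SkewPolynomial (Rn F K nl), (∀ g ∈ linearFactors F a Z, RightDvd g f) ↔
      ∀ j ∈ Z, evalHom (cls F a j) f (pt F K j) = 0 := by
    intro f
    constructor
    · intro h j hj
      exact (rightDvd_locator_iff a j f).mp (h _ ⟨j, hj, rfl⟩)
    · rintro h _ ⟨j, hj, rfl⟩
      exact (rightDvd_locator_iff a j f).mpr (h j hj)
  have key : ∀ p : SkewPolynomial (Rn F K nl), IsMinPoly a Z p →
      IsLclm (linearFactors F a Z) p := by
    intro p hp
    refine ⟨hp.1.isMonic, (hdvd p).mpr fun j hj => hp.evalHom_eq_zero hj, fun h hh hZ => ?_⟩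
    obtain ⟨u, rfl⟩ := (hp.2 h).mpr ((hdvd h).mp hZ)
    rw [hp.1.degree_eq]
    by_contra hlt
    have hd := hh.monicOfDegree
    rw [hd.degree_eq, Nat.cast_le, not_le] at hlt
    have h0 := hp.1.eq_zero_of_mul_mem (degreeLT_mono hlt hd.1)
    have h1 := hd.2
    rw [h0, zero_mul, SkewPolynomial.coeff_zero] at h1
    exact zero_ne_one h1
  refine ⟨fun h => ?_, key m⟩
  obtain ⟨p, hp⟩ := exists_isMinPoly (F := F) ha Z
  have hp' := key p hp
  have hdeg : degree m = degree p := le_antisymm (h.2.2 p hp'.1 hp'.2.1) (hp'.2.2 m h.1 h.2.1)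
  have hm := h.1.monicOfDegree
  rw [natDegree, hdeg, ← natDegree, hp.1.natDegree_eq] at hm
  rw [hm.eq_of_rightDvd hp.1 ((hp.2 m).mpr ((hdvd m).mp h.2.1))]
  exact hp

theorem existsUnique_isLclm {a : Fin ℓ → K} (ha : ∀ l, a l ≠ 0) (Z : Finset (Fin (∑ l, nl l))) :
    ∃! m : SkewPolynomial (Rn F K nl), IsLclm (linearFactors F a Z) m := by
  simp only [isLclm_iff_isMinPoly ha]
  obtain ⟨p, hp⟩ := exists_isMinPoly (F := F) ha Z
  exact ⟨p, hp, fun y hy => hy.unique hp⟩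

theorem isMinPoly_lclm {a : Fin ℓ → K} (ha : ∀ l, a l ≠ 0) (Z : Finset (Fin (∑ l, nl l))) :
    IsMinPoly a Z (lclm (linearFactors F a Z)) :=
  (isLclm_iff_isMinPoly ha Z _).mp (isLclm_lclm (existsUnique_isLclm ha Z).exists)

end MinimalPolynomials

/-! ### The skew polynomials `𝖿(Z,τ)` -/

section ZeroPolynomials

variable {F K : Type*} [Field F] [Fintype F] [Field K] [Algebra F K] {ℓ : ℕ} {nl : Fin ℓ → ℕ}
  {a : Fin ℓ → K}

theorem monicOfDegree_skewF (ha : ∀ l, a l ≠ 0) (Z : Finset (Fin (∑ l, nl l))) (τ : ℕ) :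
    MonicOfDegree (skewF F a Z τ) (τ + Z.card) :=
  (monicOfDegree_X_pow τ).mul (isMinPoly_lclm ha Z).1

/-- Zero is not a locator, so the minimal skew polynomials are prime to `X`. -/
theorem coeff_zero_lclm_ne_zero (ha : ∀ l, a l ≠ 0) (Z : Finset (Fin (∑ l, nl l))) :
    (lclm (linearFactors F a Z)).coeff 0 ≠ 0 := by
  induction Z using Finset.induction_on with
  | empty =>
    rw [(isMinPoly_lclm ha ∅).unique (isMinPoly_empty a), SkewPolynomial.coeff_one_zero]
    exact one_ne_zero
  | insert j Z hj ih =>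
    have hm := isMinPoly_lclm (F := F) ha Z
    rw [(isMinPoly_lclm ha _).unique (hm.insert ha hj), coeff_zero_mul]
    refine mul_ne_zero ?_ ih
    rw [SkewPolynomial.coeff_sub, SkewPolynomial.coeff_X_zero, SkewPolynomial.coeff_C_zero,
      zero_sub, neg_ne_zero]
    exact mul_ne_zero (cls_ne_zero ha j) (pow_ne_zero _ (hm.evalHom_ne_zero ha hj))

theorem skewF_rightDvd_iff (ha : ∀ l, a l ≠ 0) (Z : Finset (Fin (∑ l, nl l))) (τ : ℕ)
    (w : SkewPolynomial (Rn F K nl)) :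
    RightDvd (skewF F a Z τ) w ↔ RightDvd (X ^ τ) w ∧ RightDvd (lclm (linearFactors F a Z)) w := by
  constructor
  · intro h
    refine ⟨RightDvd.trans ⟨twist τ (lclm (linearFactors F a Z)), ?_⟩ h,
      RightDvd.trans ⟨X ^ τ, rfl⟩ h⟩
    rw [skewF, X_pow_mul_eq_twist]
  · rintro ⟨⟨u, hu⟩, h, rfl⟩
    -- the lowest term of `h` times the nonzero constant term of the lclm is the lowest term of `w`
    have hcoeff : ∀ i < τ, h.coeff i = 0 := by
      intro i
      induction i using Nat.strong_induction_on with
      | _ i ih =>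
        intro hi
        have h1 := coeff_mul_X_pow τ u i
        rw [← hu, if_neg (by omega), coeff_mul, Finset.sum_eq_single (i, 0)] at h1
        · refine (mul_eq_zero.mp h1).resolve_right fun h2 => ?_
          rw [← iterate_map_zero (φ : Rn F K nl →+* Rn F K nl) i] at h2
          exact coeff_zero_lclm_ne_zero ha Z (phi_injective.iterate i h2)
        · rintro ⟨b, c⟩ hbc hne
          rw [Finset.HasAntidiagonal.mem_antidiagonal] at hbc
          have hb : b < i := by
            rcases Nat.eq_zero_or_pos c with rfl | hc
            · exact (hne (Prod.ext hbc rfl)).elim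
            · simp only at hbc
              omega
          rw [ih b hb (hb.trans hi), zero_mul]
        · simp
    obtain ⟨v, rfl⟩ := exists_eq_mul_X_pow hcoeff
    exact ⟨v, mul_assoc _ _ _⟩

theorem lclm_rightDvd_lclm (ha : ∀ l, a l ≠ 0) {Z Z' : Finset (Fin (∑ l, nl l))} (h : Z' ⊆ Z) :
    RightDvd (lclm (linearFactors F a Z')) (lclm (linearFactors F a Z)) :=
  ((isMinPoly_lclm ha Z').2 _).mpr fun _ hj => (isMinPoly_lclm ha Z).evalHom_eq_zero (h hj)

theorem skewF_rightDvd_skewF (ha : ∀ l, a l ≠ 0) {Z Z' : Finset (Fin (∑ l, nl l))} {τ τ' : ℕ}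
    (hZ : Z' ⊆ Z) (hτ : τ' ≤ τ) : RightDvd (skewF F a Z' τ') (skewF F a Z τ) := by
  rw [skewF_rightDvd_iff ha]
  obtain ⟨h1, h2⟩ := (skewF_rightDvd_iff (F := F) ha Z τ (skewF F a Z τ)).mp ⟨1, (one_mul _).symm⟩
  refine ⟨RightDvd.trans ⟨X ^ (τ - τ'), ?_⟩ h1, (lclm_rightDvd_lclm ha hZ).trans h2⟩
  rw [← pow_add, Nat.sub_add_cancel hτ]

/-- Setting `β_x = 0` turns the locator `α_x` into the zero `0` of `X`. -/
theorem mapCoeff_kill_skewF (ha : ∀ l, a l ≠ 0) (Z : Finset (Fin (∑ l, nl l))) (τ : ℕ)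
    (x : Fin (∑ l, nl l)) :
    mapCoeff (kill x) (kill_phi x) (skewF F a Z τ) =
      skewF F a (Z.erase x) (if x ∈ Z then τ + 1 else τ) := by
  rw [skewF, map_mul, map_pow, mapCoeff_X]
  split_ifs with hx
  · have hx' := Finset.notMem_erase x Z
    have hm := isMinPoly_lclm (F := F) ha (Z.erase x)
    have h1 := (isMinPoly_lclm ha _).unique (hm.insert ha hx')
    rw [Finset.insert_erase hx] at h1
    have h2 := evalHom_mapCoeff (kill x) (kill_phi x) (cls F a x)
      (lclm (linearFactors F a (Z.erase x))) (pt F K x)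
    rw [kill_pt, if_pos rfl, map_zero] at h2
    rw [h1, map_mul, map_sub, mapCoeff_X, mapCoeff_C, map_mul, map_pow, ← h2,
      hm.mapCoeff_kill hx', zero_pow (Nat.sub_ne_zero_of_lt Fintype.one_lt_card), mul_zero,
      map_zero, sub_zero, skewF, pow_succ, mul_assoc]
  · rw [(isMinPoly_lclm ha Z).mapCoeff_kill hx, Finset.erase_eq_of_notMem hx, skewF]

/-- Common right divisors of two skew polynomials `𝖿(Z,τ)`. Their least common left multiple
is `𝖿(Z₁ ∪ Z₂, max τ₁ τ₂)`, so that a dimension count gives a Bézout relation for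
a nonzero constant multiple of `𝖿(Z₁ ∩ Z₂, min τ₁ τ₂)`. -/
theorem MonicOfDegree.rightDvd_skewF_inter (ha : ∀ l, a l ≠ 0) {Z₁ Z₂ : Finset (Fin (∑ l, nl l))}
    {τ₁ τ₂ d : ℕ} {h : SkewPolynomial (Rn F K nl)} (hh : MonicOfDegree h d)
    (h1 : RightDvd h (skewF F a Z₁ τ₁)) (h2 : RightDvd h (skewF F a Z₂ τ₂)) :
    RightDvd h (skewF F a (Z₁ ∩ Z₂) (min τ₁ τ₂)) := by
  have hf1 := monicOfDegree_skewF (F := F) ha Z₁ τ₁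
  have hf2 := monicOfDegree_skewF (F := F) ha Z₂ τ₂
  have hf3 := monicOfDegree_skewF (F := F) ha (Z₁ ∩ Z₂) (min τ₁ τ₂)
  have hf4 := monicOfDegree_skewF (F := F) ha (Z₁ ∪ Z₂) (max τ₁ τ₂)
  have hd1 := skewF_rightDvd_skewF (F := F) ha
    (Finset.inter_subset_left (s₁ := Z₁) (s₂ := Z₂)) (min_le_left τ₁ τ₂)
  have hd2 := skewF_rightDvd_skewF (F := F) ha
    (Finset.inter_subset_right (s₁ := Z₁) (s₂ := Z₂)) (min_le_right τ₁ τ₂)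
  have hcard := Finset.card_union_add_card_inter Z₁ Z₂
  have hc1 := Finset.card_le_card (Finset.inter_subset_left (s₁ := Z₁) (s₂ := Z₂))
  have hc2 := Finset.card_le_card (Finset.inter_subset_right (s₁ := Z₁) (s₂ := Z₂))
  set d1 := τ₁ + Z₁.card with hd1'
  set d2 := τ₂ + Z₂.card with hd2'
  set d3 := min τ₁ τ₂ + (Z₁ ∩ Z₂).card with hd3'
  set d4 := max τ₁ τ₂ + (Z₁ ∪ Z₂).card with hd4'
  have hsum : d1 + d2 = d3 + d4 := by omega
  have h31 : d3 ≤ d1 := by omega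
  have h32 : d3 ≤ d2 := by omega
  rcases Nat.eq_or_lt_of_le (show d3 ≤ d4 by omega) with heq | hlt
  · have h13 : d1 = d3 := by omega
    rw [h13] at hf1
    rwa [← hf1.eq_of_rightDvd hf3 hd1]
  -- the three multipliers have `(d4 - d1) + (d4 - d2) + 1 = d4 - d3 + 1` free coefficients
  obtain ⟨g, hg, ⟨i, hi, hne⟩, hrel⟩ := exists_relation (Finset.univ : Finset (Fin 3))
    ![skewF F a Z₁ τ₁, skewF F a Z₂ τ₂, skewF F a (Z₁ ∩ Z₂) (min τ₁ τ₂)]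
    ![d1, d2, d3] ![d4 - d1, d4 - d2, 1] (N := d4) hf3
    (by
      intro i _
      fin_cases i
      exacts [hf1, hf2, hf3])
    (by
      intro i _
      fin_cases i
      exacts [hd1, hd2, ⟨1, (one_mul _).symm⟩])
    (by
      intro i _
      fin_cases i <;> simp <;> omega)
    hlt.le
    (by
      simp [Fin.sum_univ_three]
      omega)
  have hg0 : g 0 ∈ degreeLT _ (d4 - d1) := hg 0 (Finset.mem_univ _)
  have hg2 : g 2 ∈ degreeLT _ 1 := hg 2 (Finset.mem_univ _)
  rw [Fin.sum_univ_three] at hrel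
  change g 0 * skewF F a Z₁ τ₁ + g 1 * skewF F a Z₂ τ₂ +
    g 2 * skewF F a (Z₁ ∩ Z₂) (min τ₁ τ₂) = 0 at hrel
  rw [eq_C_of_mem_degreeLT_one hg2] at hrel
  obtain ⟨u, hu⟩ := h1
  obtain ⟨v, hv⟩ := h2
  by_cases hc : (g 2).coeff 0 = 0
  · -- without the third term, `g 0 * 𝖿(Z₁,τ₁)` is a common left multiple of too small degree
    exfalso
    rw [hc, map_zero, zero_mul, add_zero] at hrel
    have hw : RightDvd (skewF F a (Z₁ ∪ Z₂) (max τ₁ τ₂)) (g 0 * skewF F a Z₁ τ₁) := by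
      have hw1 := (skewF_rightDvd_iff ha Z₁ τ₁ _).mp ⟨g 0, rfl⟩
      have hw2 := (skewF_rightDvd_iff ha Z₂ τ₂ (g 0 * skewF F a Z₁ τ₁)).mp
        ⟨-g 1, by rw [eq_neg_of_add_eq_zero_left hrel, neg_mul]⟩
      rw [skewF_rightDvd_iff ha]
      constructor
      · rcases max_choice τ₁ τ₂ with hmax | hmax <;> rw [hmax]
        exacts [hw1.1, hw2.1]
      · rw [(isMinPoly_lclm ha _).2]
        intro j hj
        rcases Finset.mem_union.mp hj with hj | hj
        · exact ((isMinPoly_lclm ha _).2 _).mp hw1.2 j hj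
        · exact ((isMinPoly_lclm ha _).2 _).mp hw2.2 j hj
    obtain ⟨w, hw⟩ := hw
    have hmem := mul_mem_degreeLT hg0 hf1.1
    rw [Nat.sub_add_cancel (by omega), hw] at hmem
    rw [hf4.eq_zero_of_mul_mem hmem, zero_mul] at hw
    rw [hw, zero_add] at hrel
    have e0 := hf1.eq_zero_of_mul hw
    have e1 := hf2.eq_zero_of_mul hrel
    have e2 := eq_C_of_mem_degreeLT_one hg2
    rw [hc, map_zero] at e2
    fin_cases i
    exacts [hne e0, hne e1, hne e2]
  · refine hh.rightDvd_of_C_mul hc ⟨-(g 0 * u + g 1 * v), ?_⟩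
    rw [eq_neg_of_add_eq_zero_right hrel, hu, hv, neg_mul, add_mul, mul_assoc, mul_assoc]

/-- The gcrd of the `𝖿(Z_i,τ_i)` is `𝖿(⋂ Z_i, min τ_i)`. -/
theorem rightDvd_skewF_inf' (ha : ∀ l, a l ≠ 0) {ι : Type*} (Z : ι → Finset (Fin (∑ l, nl l)))
    (τ : ι → ℕ) {Ω : Finset ι} (hΩ : Ω.Nonempty) {d : ℕ} {h : SkewPolynomial (Rn F K nl)}
    (hh : MonicOfDegree h d) (hdvd : ∀ i ∈ Ω, RightDvd h (skewF F a (Z i) (τ i))) :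
    RightDvd h (skewF F a (Ω.inf' hΩ Z) (Ω.inf' hΩ τ)) := by
  induction hΩ using Finset.Nonempty.cons_induction with
  | singleton i => simpa using hdvd
  | cons i s hi hs ih =>
    rw [Finset.inf'_cons hs, Finset.inf'_cons hs]
    rw [Finset.forall_mem_cons] at hdvd
    exact hh.rightDvd_skewF_inter ha hdvd.1 (ih hdvd.2)

theorem isGcrd_iff (ha : ∀ l, a l ≠ 0) {ι : Type*} (Z : ι → Finset (Fin (∑ l, nl l)))
    (τ : ι → ℕ) {Ω : Finset ι} (hΩ : Ω.Nonempty) (g : SkewPolynomial (Rn F K nl)) :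
    IsGcrd {p | ∃ i ∈ Ω, p = skewF F a (Z i) (τ i)} g ↔
      g = skewF F a (Ω.inf' hΩ Z) (Ω.inf' hΩ τ) := by
  have hD := monicOfDegree_skewF (F := F) ha (Ω.inf' hΩ Z) (Ω.inf' hΩ τ)
  have hdvd : ∀ p ∈ {p | ∃ i ∈ Ω, p = skewF F a (Z i) (τ i)},
      RightDvd (skewF F a (Ω.inf' hΩ Z) (Ω.inf' hΩ τ)) p := by
    rintro _ ⟨i, hi, rfl⟩
    exact skewF_rightDvd_skewF ha (Finset.inf'_le Z hi) (Finset.inf'_le τ hi)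
  have hle : ∀ h : SkewPolynomial (Rn F K nl), IsMonic h →
      (∀ p ∈ {p | ∃ i ∈ Ω, p = skewF F a (Z i) (τ i)}, RightDvd h p) →
      RightDvd h (skewF F a (Ω.inf' hΩ Z) (Ω.inf' hΩ τ)) := fun h hh hp =>
    rightDvd_skewF_inf' ha Z τ hΩ hh.monicOfDegree fun i hi => hp _ ⟨i, hi, rfl⟩
  have hdeg : ∀ h : SkewPolynomial (Rn F K nl), IsMonic h →
      (∀ p ∈ {p | ∃ i ∈ Ω, p = skewF F a (Z i) (τ i)}, RightDvd h p) →
      degree h ≤ degree (skewF F a (Ω.inf' hΩ Z) (Ω.inf' hΩ τ)) := by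
    intro h hh hp
    obtain ⟨u, hu⟩ := hle h hh hp
    rw [hD.degree_eq, hh.monicOfDegree.degree_eq]
    by_contra hlt
    rw [Nat.cast_le, not_le] at hlt
    have h0 := hh.monicOfDegree.eq_zero_of_mul_mem (f := u)
      (by rw [← hu]; exact degreeLT_mono hlt hD.1)
    have h1 := hD.2
    rw [hu, h0, zero_mul, SkewPolynomial.coeff_zero] at h1
    exact zero_ne_one h1
  constructor
  · intro hg
    have heq := le_antisymm (hdeg g hg.1 hg.2.1) (hg.2.2 _ hD.isMonic hdvd)
    have hm := hg.1.monicOfDegree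
    rw [natDegree, heq, ← natDegree, hD.natDegree_eq] at hm
    exact (hD.eq_of_rightDvd hm (hle g hg.1 hg.2.1)).symm
  · rintro rfl
    exact ⟨hD.isMonic, hdvd, hdeg⟩

end ZeroPolynomials

/-! ### The combinatorial condition -/

section Combinatorics

variable {ι α : Type*} [DecidableEq ι] [Fintype α] [DecidableEq α]

/-- The dimension condition `k - |⋂ Z_i| - min τ_i ≥ ∑ (k - τ_i - |Z_i|)` for all nonempty subsets
of `S`, with the minimum replaced by the value at some member of the subset. -/
def DimCondition (k : ℕ) (S : Finset ι) (Z : ι → Finset α) (τ : ι → ℕ) : Prop :=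
  (∀ i ∈ S, τ i + (Z i).card ≤ k) ∧ ∀ Ω ⊆ S, Ω.Nonempty →
    ∃ j ∈ Ω, ∑ i ∈ Ω, (k - (τ i + (Z i).card)) + (Ω.inf Z).card + τ j ≤ k

variable {k : ℕ} {S : Finset ι} {Z : ι → Finset α} {τ : ι → ℕ}

omit [DecidableEq ι] in
theorem DimCondition.mono (h : DimCondition k S Z τ) {S' : Finset ι} (hS : S' ⊆ S) :
    DimCondition k S' Z τ :=
  ⟨fun i hi => h.1 i (hS hi), fun Ω hΩ => h.2 Ω (hΩ.trans hS)⟩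

omit [DecidableEq ι] in
theorem DimCondition.sub_one (h : DimCondition k S Z τ) (hlt : ∀ i ∈ S, τ i + (Z i).card < k) :
    DimCondition (k - 1) S Z (fun i => τ i - 1) := by
  refine ⟨fun i hi => ?_, fun Ω hΩ hne => ?_⟩
  · have := hlt i hi
    dsimp only
    omega
  · obtain ⟨j, hj, hle⟩ := h.2 Ω hΩ hne
    refine ⟨j, hj, ?_⟩
    have hterm : ∀ i ∈ Ω, k - 1 - (τ i - 1 + (Z i).card) ≤ k - (τ i + (Z i).card) :=
      fun i hi => by omega
    have hk := hlt j (hΩ hj)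
    by_cases hz : ∃ i ∈ Ω, τ i = 0
    · obtain ⟨i, hi, hi0⟩ := hz
      have hlt' := Finset.sum_lt_sum hterm ⟨i, hi, by have := hlt i (hΩ hi); omega⟩
      dsimp only
      omega
    · push Not at hz
      have := Finset.sum_le_sum hterm
      have := hz j hj
      dsimp only
      omega

/-- The members of a subset for which the dimension condition is an equality can be replaced by
a single one. -/
theorem DimCondition.merge (h : DimCondition k S Z τ) {Ω : Finset ι} (hΩ : Ω ⊆ S) {i₀ j₀ : ι}
    (hi₀ : i₀ ∈ Ω) (hj₀ : j₀ ∈ Ω) (hmin : ∀ j ∈ Ω, τ j₀ ≤ τ j)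
    (htight : k ≤ ∑ i ∈ Ω, (k - (τ i + (Z i).card)) + (Ω.inf Z).card + τ j₀) :
    DimCondition k (insert i₀ (S \ Ω)) (Function.update Z i₀ (Ω.inf Z))
      (Function.update τ i₀ (τ j₀)) := by
  have hle₀ : τ j₀ + (Ω.inf Z).card ≤ k := by
    have := Finset.card_le_card (Finset.inf_le hj₀ : Ω.inf Z ≤ Z j₀)
    have := h.1 j₀ (hΩ hj₀)
    omega
  have hne : ∀ {i : ι}, i ∉ Ω → i ≠ i₀ := fun hi he => hi (he ▸ hi₀)
  refine ⟨fun i hi => ?_, fun T hT hTne => ?_⟩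
  · rcases Finset.mem_insert.mp hi with rfl | hi
    · simpa using hle₀
    · rw [Finset.mem_sdiff] at hi
      rw [Function.update_of_ne (hne hi.2), Function.update_of_ne (hne hi.2)]
      exact h.1 i hi.1
  · set U := T.erase i₀ with hU
    have hUsub : ∀ i ∈ U, i ∈ S ∧ i ∉ Ω := fun i hi => by
      rw [hU, Finset.mem_erase] at hi
      exact Finset.mem_sdiff.mp ((Finset.mem_insert.mp (hT hi.2)).resolve_left hi.1)
    have hUZ : U.inf (Function.update Z i₀ (Ω.inf Z)) = U.inf Z :=
      Finset.inf_congr rfl fun i hi => Function.update_of_ne (hne (hUsub i hi).2) _ _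
    have hUsum : ∑ i ∈ U, (k - (Function.update τ i₀ (τ j₀) i +
        (Function.update Z i₀ (Ω.inf Z) i).card)) = ∑ i ∈ U, (k - (τ i + (Z i).card)) :=
      Finset.sum_congr rfl fun i hi => by
        rw [Function.update_of_ne (hne (hUsub i hi).2), Function.update_of_ne (hne (hUsub i hi).2)]
    by_cases hmem : i₀ ∈ T
    · have hT' : T = insert i₀ U := (Finset.insert_erase hmem).symm
      have hnot : i₀ ∉ U := Finset.notMem_erase _ _
      -- the condition for `T` after merging is the one for `Ω ∪ U` before, minus the equality for `Ω`
      obtain ⟨j, hj, hle⟩ := h.2 (Ω ∪ U)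
        (Finset.union_subset hΩ fun i hi => (hUsub i hi).1) ⟨i₀, Finset.mem_union_left _ hi₀⟩
      have hdisj : Disjoint Ω U :=
        Finset.disjoint_right.mpr fun i hi => (hUsub i hi).2
      rw [Finset.sum_union hdisj, Finset.inf_union] at hle
      rw [hT', Finset.sum_insert hnot, Finset.inf_insert, hUZ, hUsum, Function.update_self,
        Function.update_self]
      rcases Finset.mem_union.mp hj with hj | hj
      · refine ⟨i₀, Finset.mem_insert_self _ _, ?_⟩
        have := hmin j hj
        rw [Function.update_self]
        omega
      · refine ⟨j, Finset.mem_insert_of_mem hj, ?_⟩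
        rw [Function.update_of_ne (hne (hUsub j hj).2)]
        omega
    · have hT' : T = U := (Finset.erase_eq_of_notMem hmem).symm
      have hTne' : U.Nonempty := hT' ▸ hTne
      rw [hT', hUZ, hUsum]
      obtain ⟨j, hj, hle⟩ := h.2 U (fun i hi => (hUsub i hi).1) hTne'
      refine ⟨j, hj, ?_⟩
      rw [Function.update_of_ne (hne (hUsub j hj).2)]
      exact hle

omit [DecidableEq ι] [Fintype α] in
theorem card_erase_add (Z : Finset α) (t : ℕ) (x : α) :
    (if x ∈ Z then t + 1 else t) + (Z.erase x).card = t + Z.card := by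
  split_ifs with h
  · have := Finset.card_erase_add_one h
    omega
  · rw [Finset.erase_eq_of_notMem h]

omit [DecidableEq ι] in
/-- If no proper subset with at least two members satisfies the dimension condition with equality,
a point outside some `Z_i` with `τ_i = 0` can be moved from the sets to the exponents. -/
theorem DimCondition.move (h : DimCondition k S Z τ)
    (hstrict : ∀ Ω ⊆ S, 2 ≤ Ω.card → Ω.card < S.card →
      ∃ j ∈ Ω, ∑ i ∈ Ω, (k - (τ i + (Z i).card)) + (Ω.inf Z).card + τ j < k)
    {i₀ : ι} (hi₀ : i₀ ∈ S) (hτ : τ i₀ = 0) {x : α} (hx : x ∉ Z i₀) :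
    DimCondition k S (fun i => (Z i).erase x) (fun i => if x ∈ Z i then τ i + 1 else τ i) := by
  have hinf : ∀ Ω : Finset ι, (Ω.inf fun i => (Z i).erase x).card ≤ (Ω.inf Z).card := fun Ω =>
    Finset.card_le_card (Finset.inf_mono_fun fun i _ => Finset.erase_subset _ _)
  have hτ' : ∀ i, (if x ∈ Z i then τ i + 1 else τ i) ≤ τ i + 1 := fun i => by
    split_ifs <;> omega
  refine ⟨fun i hi => ?_, fun Ω hΩ hne => ?_⟩
  · rw [card_erase_add]
    exact h.1 i hi
  simp only [card_erase_add]
  rcases Nat.lt_or_ge Ω.card 2 with h2 | h2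
  · have h1 : Ω.card = 1 := by
      have := hne.card_pos
      omega
    obtain ⟨i, rfl⟩ := Finset.card_eq_one.mp h1
    refine ⟨i, Finset.mem_singleton_self i, ?_⟩
    have h3 := h.1 i (hΩ (Finset.mem_singleton_self i))
    have h4 := card_erase_add (Z i) (τ i) x
    rw [Finset.sum_singleton, Finset.inf_singleton]
    omega
  · rcases Nat.lt_or_ge Ω.card S.card with h3 | h3
    · obtain ⟨j, hj, hlt⟩ := hstrict Ω hΩ h2 h3
      refine ⟨j, hj, ?_⟩
      have := hinf Ω
      have := hτ' j
      omega
    · -- the exponent at `i₀` stays `0`, so that the minimum over `S` does not grow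
      obtain rfl := Finset.eq_of_subset_of_card_le hΩ h3
      obtain ⟨j, hj, hle⟩ := h.2 Ω hΩ hne
      refine ⟨i₀, hi₀, ?_⟩
      have := hinf Ω
      rw [if_neg hx]
      omega

theorem DimCondition.exists_mem_notMem (h : DimCondition k S Z τ) {i₁ i₂ : ι} (h1 : i₁ ∈ S)
    (h2 : i₂ ∈ S) (hne : i₁ ≠ i₂) (hlt : (Z i₁).card < k) (hτ1 : τ i₁ = 0) (hτ2 : τ i₂ = 0) :
    ∃ x ∈ Z i₂, x ∉ Z i₁ := by
  by_contra hcon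
  push Not at hcon
  obtain ⟨j, hj, hle⟩ := h.2 {i₁, i₂} (by
    intro i hi
    rcases Finset.mem_insert.mp hi with rfl | hi
    · exact h1
    · rwa [Finset.mem_singleton.mp hi]) ⟨i₁, Finset.mem_insert_self _ _⟩
  have hcard := h.1 i₂ h2
  rw [Finset.sum_pair hne, Finset.inf_insert, Finset.inf_singleton,
    inf_eq_right.mpr (show Z i₂ ≤ Z i₁ from hcon)] at hle
  omega

end Combinatorics

/-! ### Independence -/

section Independence

variable {F K : Type*} [Field F] [Fintype F] [Field K] [Algebra F K] {ℓ : ℕ} {nl : Fin ℓ → ℕ}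
  {a : Fin ℓ → K} {ι : Type*}

/-- The products of degree less than `k` of the `𝖿(Z_i,τ_i)`, `i ∈ S`, are independent, also after
any power of the Frobenius has been applied to the coefficients of the `𝖿(Z_i,τ_i)`. -/
def Independent (F : Type*) {K : Type*} [Field F] [Fintype F] [Field K] [Algebra F K] {ℓ : ℕ}
    {nl : Fin ℓ → ℕ} {ι : Type*} (a : Fin ℓ → K) (k : ℕ) (S : Finset ι)
    (Z : ι → Finset (Fin (∑ l, nl l))) (τ : ι → ℕ) : Prop :=
  ∀ (e : ℕ) (g : ι → SkewPolynomial (Rn F K nl)),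
    (∀ i ∈ S, g i ∈ degreeLT _ (k - (τ i + (Z i).card))) →
    ∑ i ∈ S, g i * twist e (skewF F a (Z i) (τ i)) = 0 → ∀ i ∈ S, g i = 0

variable {k : ℕ} {S : Finset ι} {Z : ι → Finset (Fin (∑ l, nl l))} {τ : ι → ℕ}

theorem monicOfDegree_twist_skewF (ha : ∀ l, a l ≠ 0) (e : ℕ) (Z : Finset (Fin (∑ l, nl l)))
    (τ : ℕ) : MonicOfDegree (twist e (skewF F a Z τ)) (τ + Z.card) :=
  (monicOfDegree_skewF ha Z τ).mapCoeff _ _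

theorem Independent.of_erase [DecidableEq ι] {i₀ : ι} (hi₀ : i₀ ∈ S)
    (hk : k ≤ τ i₀ + (Z i₀).card)
    (h : Independent F a k (S.erase i₀) Z τ) : Independent F a k S Z τ := by
  intro e g hg hrel
  have h0 : g i₀ = 0 := by
    refine eq_zero_of_mem_degreeLT_zero ?_
    have := hg i₀ hi₀
    rwa [Nat.sub_eq_zero_of_le hk] at this
  rw [← Finset.add_sum_erase S _ hi₀, h0, zero_mul, zero_add] at hrel
  intro i hi
  by_cases hii : i = i₀
  · rw [hii, h0]
  · exact h e g (fun i hi => hg i (Finset.mem_of_mem_erase hi)) hrel i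
      (Finset.mem_erase.mpr ⟨hii, hi⟩)

theorem twist_skewF_succ (a : Fin ℓ → K) (e : ℕ) (Z : Finset (Fin (∑ l, nl l))) (t : ℕ) :
    X * twist e (skewF F a Z t) = twist e (skewF F a Z (t + 1)) := by
  rw [skewF, skewF, pow_succ', mul_assoc, map_mul (twist e) X, twist_X]

/-- If at most one exponent vanishes, the constant coefficients of a relation show that all
its terms are right divisible by `X`, and `X` can be cancelled. -/
theorem Independent.of_sub_one (ha : ∀ l, a l ≠ 0)
    (hzero : ∀ i ∈ S, ∀ j ∈ S, τ i = 0 → τ j = 0 → i = j)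
    (h : Independent F a (k - 1) S Z (fun i => τ i - 1)) : Independent F a k S Z τ := by
  intro e g hg hrel
  have hsplit : ∀ i ∈ S, ∃ g', g' ∈ degreeLT (Rn F K nl) (k - 1 - (τ i - 1 + (Z i).card)) ∧
      g i * twist e (skewF F a (Z i) (τ i)) =
        g' * twist (e + 1) (skewF F a (Z i) (τ i - 1)) * X ∧ (g' = 0 → g i = 0) := by
    intro i hi
    by_cases hi0 : τ i = 0
    · -- all other terms have an `X` on the left of `𝖿(Z_j,τ_j)`, hence no constant coefficient
      have hterm : ∀ j ∈ S, j ≠ i → (g j * twist e (skewF F a (Z j) (τ j))).coeff 0 = 0 := by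
        intro j hj hji
        have hj0 : τ j ≠ 0 := fun h0 => hji (hzero j hj i hi h0 hi0)
        obtain ⟨t, ht⟩ := Nat.exists_eq_succ_of_ne_zero hj0
        rw [ht, Nat.succ_eq_add_one, ← twist_skewF_succ, coeff_zero_mul, coeff_zero_mul,
          SkewPolynomial.coeff_X_zero, zero_mul, mul_zero]
      have h0 := congr_arg (fun p => p.coeff 0) hrel
      simp only [coeff_sum] at h0
      rw [Finset.sum_eq_single_of_mem i hi hterm, coeff_zero_mul, coeff_twist, hi0, skewF,
        pow_zero, one_mul, SkewPolynomial.coeff_zero] at h0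
      have hg0 : (g i).coeff 0 = 0 := by
        refine (mul_eq_zero.mp h0).resolve_right fun h2 => ?_
        rw [← iterate_map_zero (φ : Rn F K nl →+* Rn F K nl) e] at h2
        exact coeff_zero_lclm_ne_zero ha (Z i) (phi_injective.iterate e h2)
      obtain ⟨g', hg'⟩ := exists_eq_mul_X_pow (n := 1) (f := g i) (fun m hm => by
        obtain rfl : m = 0 := by omega
        exact hg0)
      refine ⟨g', ?_, ?_, fun h => by rw [hg', h, zero_mul]⟩
      · rcases Nat.lt_or_ge (τ i + (Z i).card) k with hlt | hge
        · refine (monicOfDegree_X_pow 1).mem_degreeLT_of_mul ?_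
          rw [← hg', hi0]
          have := hg i hi
          rw [hi0] at this
          convert this using 2
          omega
        · have h1 : g i = 0 := by
            refine eq_zero_of_mem_degreeLT_zero ?_
            have := hg i hi
            rwa [Nat.sub_eq_zero_of_le hge] at this
          rw [(monicOfDegree_X_pow 1).eq_zero_of_mul (hg'.symm.trans h1)]
          exact Submodule.zero_mem _
      · rw [hg', hi0, pow_one, mul_assoc, X_mul_twist, mul_assoc]
    · obtain ⟨t, ht⟩ := Nat.exists_eq_succ_of_ne_zero hi0
      refine ⟨g i, ?_, ?_, id⟩
      · have := hg i hi
        refine degreeLT_mono ?_ this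
        omega
      · rw [ht, Nat.succ_eq_add_one, ← twist_skewF_succ, X_mul_twist, Nat.add_sub_cancel,
          mul_assoc]
  choose! g' hg' heq himp using hsplit
  rw [Finset.sum_congr rfl heq, ← Finset.sum_mul, ← pow_one X] at hrel
  intro i hi
  exact himp i hi (h (e + 1) g' hg' ((monicOfDegree_X_pow 1).eq_zero_of_mul hrel) i hi)

/-- A relation between the `𝖿(Z_i,τ_i)`, `i ∈ S`, in which the terms with `i ∈ Ω` are collected
is a relation in which these `𝖿(Z_i,τ_i)` are replaced by a common right divisor. -/
theorem Independent.of_merge [DecidableEq ι] (ha : ∀ l, a l ≠ 0)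
    (hdeg : ∀ i ∈ S, τ i + (Z i).card ≤ k) {Ω : Finset ι} (hΩ : Ω ⊆ S)
    {i₀ : ι} (hi₀ : i₀ ∈ Ω) {t : ℕ} (hmin : ∀ j ∈ Ω, t ≤ τ j)
    (h1 : Independent F a k Ω Z τ)
    (h2 : Independent F a k (insert i₀ (S \ Ω)) (Function.update Z i₀ (Ω.inf Z))
      (Function.update τ i₀ t)) : Independent F a k S Z τ := by
  intro e g hg hrel
  have hD := monicOfDegree_twist_skewF (F := F) ha e (Ω.inf Z) t
  have hle : t + (Ω.inf Z).card ≤ k := by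
    have := Finset.card_le_card (Finset.inf_le hi₀ : Ω.inf Z ≤ Z i₀)
    have := hmin i₀ hi₀
    have := hdeg i₀ (hΩ hi₀)
    omega
  have hdvd : ∀ i ∈ Ω, ∃ u, g i * twist e (skewF F a (Z i) (τ i)) =
      u * twist e (skewF F a (Ω.inf Z) t) := by
    intro i hi
    obtain ⟨v, hv⟩ := skewF_rightDvd_skewF (F := F) ha (Finset.inf_le hi : Ω.inf Z ≤ Z i)
      (hmin i hi)
    exact ⟨g i * twist e v, by rw [hv, map_mul, mul_assoc]⟩
  choose! u hu using hdvd
  have hsum : ∑ i ∈ Ω, g i * twist e (skewF F a (Z i) (τ i)) =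
      (∑ i ∈ Ω, u i) * twist e (skewF F a (Ω.inf Z) t) := by
    rw [Finset.sum_mul]
    exact Finset.sum_congr rfl hu
  have hmem : ∑ i ∈ Ω, u i ∈ degreeLT (Rn F K nl) (k - (t + (Ω.inf Z).card)) := by
    refine hD.mem_degreeLT_of_mul ?_
    rw [← hsum, Nat.sub_add_cancel hle]
    refine Submodule.sum_mem _ fun i hi => ?_
    have := mul_mem_degreeLT (hg i (hΩ hi)) (monicOfDegree_twist_skewF ha e (Z i) (τ i)).1
    rwa [Nat.sub_add_cancel (hdeg i (hΩ hi))] at this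
  have hnot : i₀ ∉ S \ Ω := fun h => (Finset.mem_sdiff.mp h).2 hi₀
  have hne : ∀ i ∈ S \ Ω, i ≠ i₀ := fun i hi he => hnot (he ▸ hi)
  have hrest := h2 e (Function.update g i₀ (∑ i ∈ Ω, u i))
    (by
      intro i hi
      rcases Finset.mem_insert.mp hi with rfl | hi
      · simpa using hmem
      · simp only [Function.update_of_ne (hne i hi)]
        exact hg i (Finset.mem_sdiff.mp hi).1)
    (by
      have hrest : ∑ i ∈ S \ Ω, Function.update g i₀ (∑ i ∈ Ω, u i) i *
          twist e (skewF F a (Function.update Z i₀ (Ω.inf Z) i) (Function.update τ i₀ t i)) =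
          ∑ i ∈ S \ Ω, g i * twist e (skewF F a (Z i) (τ i)) :=
        Finset.sum_congr rfl fun i hi => by simp only [Function.update_of_ne (hne i hi)]
      have hsplit := Finset.sum_sdiff (f := fun i => g i * twist e (skewF F a (Z i) (τ i))) hΩ
      rw [hrel, hsum, add_comm] at hsplit
      rw [Finset.sum_insert hnot, hrest]
      simp only [Function.update_self]
      exact hsplit)
  have hout : ∀ i ∈ S \ Ω, g i = 0 := fun i hi => by
    have := hrest i (Finset.mem_insert_of_mem hi)
    rwa [Function.update_of_ne (hne i hi)] at this
  have hin : ∑ i ∈ Ω, g i * twist e (skewF F a (Z i) (τ i)) = 0 := by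
    have h0 : ∑ i ∈ S \ Ω, g i * twist e (skewF F a (Z i) (τ i)) = 0 :=
      Finset.sum_eq_zero fun i hi => by rw [hout i hi, zero_mul]
    rwa [← Finset.sum_sdiff hΩ, h0, zero_add] at hrel
  intro i hi
  by_cases hiΩ : i ∈ Ω
  · exact h1 e g (fun i hi => hg i (hΩ hi)) hin i hiΩ
  · exact hout i (Finset.mem_sdiff.mpr ⟨hi, hiΩ⟩)

/-- Independence can be tested after setting a variable to zero: otherwise the coefficients of
a relation are divisible by every power of this variable. -/
theorem Independent.of_kill (ha : ∀ l, a l ≠ 0) (x : Fin (∑ l, nl l))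
    (h : Independent F a k S (fun i => (Z i).erase x)
      (fun i => if x ∈ Z i then τ i + 1 else τ i)) : Independent F a k S Z τ := by
  intro e g hg hrel
  have hpow : ∀ (N : ℕ) (g : ι → SkewPolynomial (Rn F K nl)),
      (∀ i ∈ S, g i ∈ degreeLT _ (k - (τ i + (Z i).card))) →
      ∑ i ∈ S, g i * twist e (skewF F a (Z i) (τ i)) = 0 →
      ∀ i ∈ S, ∀ n, pt F K x ^ N ∣ (g i).coeff n := by
    intro N
    induction N with
    | zero =>
      intro g _ _ i _ n
      rw [pow_zero]
      exact one_dvd _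
    | succ N ih =>
      intro g hg hrel
      have hspec : ∀ i ∈ S, mapCoeff (kill x) (kill_phi x) (g i) = 0 := by
        refine h e (fun i => mapCoeff (kill x) (kill_phi x) (g i)) (fun i hi => ?_) ?_
        · simp only [card_erase_add]
          exact mapCoeff_mem_degreeLT _ _ (hg i hi)
        · rw [← map_zero (mapCoeff (kill x) (kill_phi x)), ← hrel, map_sum]
          refine Finset.sum_congr rfl fun i _ => ?_
          rw [map_mul, ← twist_mapCoeff, mapCoeff_kill_skewF ha]
      have hdvd : ∀ i ∈ S, ∃ g', g i = C (pt F K x) * g' := by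
        intro i hi
        have hc : ∀ n, ∃ c, (g i).coeff n = pt F K x * c := fun n => by
          refine pt_dvd_of_kill_eq_zero ?_
          rw [← coeff_mapCoeff (kill x) (kill_phi x), hspec i hi, SkewPolynomial.coeff_zero]
        choose c hc using hc
        obtain ⟨M, hM⟩ := exists_mem_degreeLT (g i)
        refine ⟨ofVec M fun r => c r, ?_⟩
        ext n
        rw [coeff_C_mul, coeff_ofVec]
        split_ifs with hn
        · exact hc n
        · rw [hM n (by omega), mul_zero]
      choose! g' hg' using hdvd
      have hcancel : ∀ p : SkewPolynomial (Rn F K nl), ∀ n,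
          (C (pt F K x) * p).coeff n = 0 → p.coeff n = 0 := fun p n hp => by
        rw [coeff_C_mul] at hp
        exact (mul_eq_zero.mp hp).resolve_left (pt_ne_zero x)
      have hih := ih g'
        (fun i hi n hn => hcancel _ n (by rw [← hg' i hi]; exact hg i hi n hn))
        (by
          ext n
          refine hcancel _ n ?_
          have hsum : C (pt F K x) * ∑ i ∈ S, g' i * twist e (skewF F a (Z i) (τ i)) =
              ∑ i ∈ S, g i * twist e (skewF F a (Z i) (τ i)) := by
            rw [Finset.mul_sum]
            refine Finset.sum_congr rfl fun i hi => ?_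
            rw [hg' i hi, mul_assoc]
          rw [hsum, hrel, SkewPolynomial.coeff_zero])
      intro i hi n
      rw [hg' i hi, coeff_C_mul, pow_succ']
      exact mul_dvd_mul_left _ (hih i hi n)
  intro i hi
  ext n
  exact eq_zero_of_forall_pow_dvd fun N => hpow N g hg hrel i hi n

/-- The dimension condition implies independence. If the condition is an equality for
a proper subset with at least two members, these are merged; if at most one exponent vanishes,
a power of `X` is cancelled; otherwise a variable is set to zero. Each step decreases
`k + |S| + ∑ |Z_i|`. -/
theorem DimCondition.independent (ha : ∀ l, a l ≠ 0) (h : DimCondition k S Z τ) :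
    Independent F a k S Z τ := by
  classical
  induction hN : k + S.card + ∑ i ∈ S, (Z i).card using Nat.strong_induction_on
    generalizing k S Z τ with
  | _ N ih =>
  by_cases hfull : ∃ i ∈ S, k ≤ τ i + (Z i).card
  · obtain ⟨i, hi, hk⟩ := hfull
    refine Independent.of_erase hi hk (ih _ ?_ (h.mono (Finset.erase_subset i S)) rfl)
    have h1 := Finset.card_erase_add_one hi
    have h2 := Finset.add_sum_erase S (fun i => (Z i).card) hi
    omega
  push Not at hfull
  by_cases hzero : ∀ i ∈ S, ∀ j ∈ S, τ i = 0 → τ j = 0 → i = j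
  · rcases S.eq_empty_or_nonempty with rfl | ⟨i, hi⟩
    · intro e g _ _ i hi
      exact absurd hi (Finset.notMem_empty i)
    · refine Independent.of_sub_one ha hzero (ih _ ?_ (h.sub_one hfull) rfl)
      have := hfull i hi
      omega
  push Not at hzero
  obtain ⟨i₁, h1, i₂, h2, hτ1, hτ2, hne⟩ := hzero
  by_cases htight : ∃ Ω ⊆ S, 2 ≤ Ω.card ∧ Ω.card < S.card ∧
      ∀ j ∈ Ω, k ≤ ∑ i ∈ Ω, (k - (τ i + (Z i).card)) + (Ω.inf Z).card + τ j
  · obtain ⟨Ω, hΩ, hcard, hcard', htight⟩ := htight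
    have hΩne : Ω.Nonempty := Finset.card_pos.mp (by omega)
    obtain ⟨j₀, hj₀, hmin⟩ := Finset.exists_min_image Ω τ hΩne
    have hsum := Finset.sum_sdiff (f := fun i => (Z i).card) hΩ
    have hcs := Finset.card_sdiff_add_card_eq_card hΩ
    have hnot : j₀ ∉ S \ Ω := fun h => (Finset.mem_sdiff.mp h).2 hj₀
    refine Independent.of_merge ha h.1 hΩ hj₀ hmin (ih _ ?_ (h.mono hΩ) rfl)
      (ih _ ?_ (h.merge hΩ hj₀ hj₀ hmin (htight j₀ hj₀)) rfl)
    · omega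
    · rw [Finset.card_insert_of_notMem hnot, Finset.sum_insert hnot, Function.update_self]
      have hrest : ∑ i ∈ S \ Ω, (Function.update Z j₀ (Ω.inf Z) i).card =
          ∑ i ∈ S \ Ω, (Z i).card :=
        Finset.sum_congr rfl fun i hi => by
          rw [Function.update_of_ne]
          rintro rfl
          exact hnot hi
      have hinf := Finset.card_le_card (Finset.inf_le hj₀ : Ω.inf Z ≤ Z j₀)
      have hsingle := Finset.single_le_sum (f := fun i => (Z i).card)
        (fun i _ => Nat.zero_le _) hj₀
      omega
  push Not at htight
  obtain ⟨x, hx2, hx1⟩ := h.exists_mem_notMem h1 h2 hne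
    (by have := hfull i₁ h1; omega) hτ1 hτ2
  refine Independent.of_kill ha x (ih _ ?_ (h.move htight h1 hτ1 hx1) rfl)
  have hlt : ∑ i ∈ S, ((Z i).erase x).card < ∑ i ∈ S, (Z i).card :=
    Finset.sum_lt_sum (fun i _ => Finset.card_le_card (Finset.erase_subset _ _))
      ⟨i₂, h2, Finset.card_erase_lt_of_mem hx2⟩
  omega

end Independence

/-! ### Full row rank over a domain -/

section Rank

variable {R : Type*} [CommRing R] [IsDomain R] {m n : Type*} [Fintype m] [Fintype n]

theorem eq_zero_of_vecMul_eq_zero_of_rank_eq (M : Matrix m n R)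
    (h : M.rank = Fintype.card m) {v : m → R} (hv : Matrix.vecMul v M = 0) : v = 0 := by
  classical
  obtain ⟨w, hw⟩ := exists_linearIndependent_of_le_finrank
    (show Fintype.card m ≤ Module.finrank R M.mulVecLin.range from h.ge)
  let e := Fintype.equivFin m
  choose x hx using fun i => (w i).2
  -- the columns of `W = M * A` are independent and lie in the column space of `M`
  let A : Matrix n m R := Matrix.of fun j i => x (e i) j
  have hcol : ∀ i, (M * A).col i = w (e i) := fun i => hx (e i)
  by_contra hne
  have hdet : (M * A).det = 0 :=
    Matrix.exists_vecMul_eq_zero_iff.mp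
      ⟨v, hne, by rw [← Matrix.vecMul_vecMul, hv, Matrix.zero_vecMul]⟩
  obtain ⟨c, hc, hc0⟩ := Matrix.exists_mulVec_eq_zero_iff.mpr hdet
  have hsum : ∑ i, c (e.symm i) • w i = 0 := by
    apply Subtype.ext
    rw [← e.sum_comp]
    simp only [Equiv.symm_apply_apply, Submodule.coe_sum, Submodule.coe_smul, ← hcol]
    rw [Matrix.mulVec_eq_sum] at hc0
    refine Eq.trans ?_ hc0
    refine Finset.sum_congr rfl fun i _ => ?_
    ext r
    simp [mul_comm, -Matrix.transpose_mul]
  refine hc (funext fun i => ?_)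
  have := Fintype.linearIndependent_iff.mp hw _ hsum (e i)
  simpa using this

theorem rank_eq_card_of_vecMul (M : Matrix m n R)
    (h : ∀ v : m → R, Matrix.vecMul v M = 0 → v = 0) : M.rank = Fintype.card m := by
  classical
  -- a right inverse of `M` over the field of fractions, with denominators cleared
  let L := FractionRing R
  let ML : Matrix m n L := M.map (algebraMap R L)
  have hinj : LinearMap.ker ML.vecMulLinear = ⊥ := by
    rw [LinearMap.ker_eq_bot, Matrix.coe_vecMulLinear, Matrix.vecMul_injective_iff,
      ← LinearIndependent.iff_fractionRing (R := R) (K := L), Fintype.linearIndependent_iff]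
    intro g hg i
    refine congr_fun (h g ?_) i
    ext j
    apply IsFractionRing.injective R L
    have := congr_fun hg j
    simp only [Finset.sum_apply, Pi.zero_apply, Algebra.smul_def] at this
    simpa [Matrix.vecMul, dotProduct, ML] using this
  obtain ⟨G, hG⟩ := LinearMap.exists_leftInverse_of_injective _ hinj
  let B : Matrix n m L := (LinearMap.toMatrix' G).transpose
  have hB : ML * B = 1 := by
    have hv : ∀ v, Matrix.vecMul (Matrix.vecMul v ML) B = v := fun v => by
      rw [Matrix.vecMul_transpose, LinearMap.toMatrix'_mulVec]
      exact LinearMap.congr_fun hG v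
    ext i j
    have := congr_fun (hv (Pi.single i 1)) j
    rw [Matrix.vecMul_vecMul, Matrix.single_one_vecMul, Pi.single_apply] at this
    rw [Matrix.one_apply]
    simpa [eq_comm] using this
  obtain ⟨c, hc⟩ := IsLocalization.exist_integer_multiples_of_finite (nonZeroDivisors R)
    (fun p : n × m => B p.1 p.2)
  choose A hA using hc
  have hMA : M * Matrix.of (fun j i => A (j, i)) = (c : R) • (1 : Matrix m m R) := by
    ext i j
    apply IsFractionRing.injective R L
    have hij := congr_fun (congr_fun hB i) j
    simp only [Matrix.mul_apply, Matrix.of_apply, map_sum, map_mul, hA, Algebra.smul_def,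
      Matrix.smul_apply]
    rw [Matrix.mul_apply] at hij
    calc ∑ r, algebraMap R L (M i r) * (algebraMap R L c * B r j)
        = algebraMap R L c * ∑ r, ML i r * B r j := by
          rw [Finset.mul_sum]
          exact Finset.sum_congr rfl fun r _ => mul_left_comm _ _ _
      _ = _ := by
          rw [hij, Matrix.one_apply, Matrix.one_apply]
          split_ifs <;> simp
  refine le_antisymm (Matrix.rank_le_card_height M) ?_
  refine le_trans ?_ (Matrix.rank_mul_le_left M (Matrix.of (fun j i => A (j, i))))
  rw [Matrix.rank_of_det_ne_zero]
  rw [hMA, Matrix.det_smul, Matrix.det_one, mul_one]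
  exact pow_ne_zero _ (nonZeroDivisors.ne_zero c.2)

end Rank

/-! ### Relations, ranks and determinants -/

section Main

variable {F K : Type*} [Field F] [Fintype F] [Field K] [Algebra F K] {ℓ : ℕ} {nl : Fin ℓ → ℕ}
  {a : Fin ℓ → K}

/-- The only relation `∑ g_i 𝖿(Z_i,τ_i) = 0` with all terms of degree less than `k` is the trivial
one. -/
def NoRelation (F : Type*) {K : Type*} [Field F] [Fintype F] [Field K] [Algebra F K] {ℓ : ℕ}
    {nl : Fin ℓ → ℕ} (a : Fin ℓ → K) (k : ℕ) {s : ℕ} (Z : Fin s → Finset (Fin (∑ l, nl l)))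
    (τ : Fin s → ℕ) : Prop :=
  ∀ g : Fin s → SkewPolynomial (Rn F K nl), (∀ i, g i ∈ degreeLT _ (k - (τ i + (Z i).card))) →
    ∑ i, g i * skewF F a (Z i) (τ i) = 0 → ∀ i, g i = 0

variable {k s : ℕ} {Z : Fin s → Finset (Fin (∑ l, nl l))} {τ : Fin s → ℕ}

theorem noRelation_iff_degree (ha : ∀ l, a l ≠ 0) (hk : 1 ≤ k)
    (hZ : ∀ i, τ i + (Z i).card ≤ k) :
    NoRelation F a k Z τ ↔ ∀ g : Fin s → SkewPolynomial (Rn F K nl),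
      (∀ i, degree (g i * skewF F a (Z i) (τ i)) ≤ ((k - 1 : ℕ) : WithBot ℕ)) →
      ∑ i, g i * skewF F a (Z i) (τ i) = 0 → ∀ i, g i = 0 := by
  refine forall_congr' fun g => ?_
  have h : ∀ i, g i ∈ degreeLT _ (k - (τ i + (Z i).card)) ↔
      degree (g i * skewF F a (Z i) (τ i)) ≤ ((k - 1 : ℕ) : WithBot ℕ) := by
    intro i
    have hf := monicOfDegree_skewF (F := F) ha (Z i) (τ i)
    rw [degree_le_iff, Nat.sub_add_cancel hk]
    constructor
    · intro hg
      have := mul_mem_degreeLT hg hf.1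
      rwa [Nat.sub_add_cancel (hZ i)] at this
    · intro hg
      refine hf.mem_degreeLT_of_mul ?_
      rwa [Nat.sub_add_cancel (hZ i)]
  rw [forall_congr' h]

theorem noRelation_iff_dim (ha : ∀ l, a l ≠ 0) (hZ : ∀ i, τ i + (Z i).card ≤ k) :
    NoRelation F a k Z τ ↔ ∀ (Ω : Finset (Fin s)) (hΩ : Ω.Nonempty),
      (k : ℤ) - (Ω.inf' hΩ Z).card - (Ω.inf' hΩ τ : ℕ) ≥
        ∑ i ∈ Ω, ((k : ℤ) - τ i - (Z i).card) := by
  have hsum : ∀ Ω : Finset (Fin s), ∑ i ∈ Ω, ((k : ℤ) - τ i - (Z i).card) =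
      ((∑ i ∈ Ω, (k - (τ i + (Z i).card)) : ℕ) : ℤ) := by
    intro Ω
    rw [Nat.cast_sum]
    refine Finset.sum_congr rfl fun i _ => ?_
    rw [Nat.cast_sub (hZ i)]
    push_cast
    ring
  simp only [hsum]
  constructor
  · intro h Ω hΩ
    by_contra hcon
    have hD := monicOfDegree_skewF (F := F) ha (Ω.inf' hΩ Z) (Ω.inf' hΩ τ)
    obtain ⟨i₀, hi₀⟩ := hΩ
    have hle : Ω.inf' ⟨i₀, hi₀⟩ τ + (Ω.inf' ⟨i₀, hi₀⟩ Z).card ≤ k := by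
      have h1 := Finset.card_le_card (Finset.inf'_le Z hi₀ : Ω.inf' ⟨i₀, hi₀⟩ Z ≤ Z i₀)
      have h2 := Finset.inf'_le τ hi₀
      have h3 := hZ i₀
      omega
    obtain ⟨g, hg, ⟨i, hi, hne⟩, hrel⟩ := exists_relation Ω (fun i => skewF F a (Z i) (τ i))
      (fun i => τ i + (Z i).card) (fun i => k - (τ i + (Z i).card)) (N := k) hD
      (fun i _ => monicOfDegree_skewF ha (Z i) (τ i))
      (fun i hi => skewF_rightDvd_skewF ha (Finset.inf'_le Z hi) (Finset.inf'_le τ hi))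
      (fun i _ => by rw [Nat.sub_add_cancel (hZ i)]) hle (by omega)
    classical
    have := h (fun i => if i ∈ Ω then g i else 0) (fun i => by
      split_ifs with hi
      · exact hg i hi
      · exact Submodule.zero_mem _) (by
      simp only [ite_mul, zero_mul, Finset.sum_ite_mem, Finset.univ_inter]
      exact hrel) i
    rw [if_pos hi] at this
    exact hne this
  · intro h
    have hdim : DimCondition k Finset.univ Z τ := by
      refine ⟨fun i _ => hZ i, fun Ω _ hΩ => ?_⟩
      obtain ⟨j, hj, hjτ⟩ := Finset.exists_mem_eq_inf' hΩ τ
      refine ⟨j, hj, ?_⟩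
      have := h Ω hΩ
      rw [hjτ, Finset.inf'_eq_inf] at this
      omega
    intro g hg hrel i
    refine hdim.independent ha 0 g (fun i _ => hg i) ?_ i (Finset.mem_univ i)
    simp only [twist_zero]
    exact hrel

theorem ofVec_mul_coeff {R : Type*} [CommRing R] [MulSemiringAction (Multiplicative ℕ) R] {n : ℕ}
    (v : Fin n → R) (f : SkewPolynomial R) (c : ℕ) :
    (ofVec n v * f).coeff c =
      ∑ r : Fin n, v r * if (r : ℕ) ≤ c then φ^[(r : ℕ)] (f.coeff (c - r)) else 0 := by
  rw [ofVec, Finset.sum_mul, coeff_sum]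
  refine Finset.sum_congr rfl fun r _ => ?_
  rw [← mul_one (v r), ← SkewPolynomial.C_mul_monomial, SkewPolynomial.monomial_one_right_eq_X_pow,
    mul_assoc, coeff_C_mul, coeff_X_pow_mul, mul_one]

/-- The vanishing linear combinations of the rows of the stacked matrix are the relations between
the `𝖿(Z_i,τ_i)`. -/
theorem vecMul_stackedMat (ha : ∀ l, a l ≠ 0) (hZ : ∀ i, τ i + (Z i).card ≤ k)
    (v : (Σ i : Fin s, Fin (k - τ i - (Z i).card)) → Rn F K nl) :
    Matrix.vecMul v (stackedMat F a k Z τ) = 0 ↔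
      ∑ i, ofVec (k - τ i - (Z i).card) (fun r => v ⟨i, r⟩) * skewF F a (Z i) (τ i) = 0 := by
  have hcoeff : ∀ c : Fin k, Matrix.vecMul v (stackedMat F a k Z τ) c =
      (∑ i, ofVec (k - τ i - (Z i).card) (fun r => v ⟨i, r⟩) *
        skewF F a (Z i) (τ i)).coeff c := by
    intro c
    rw [coeff_sum, Matrix.vecMul, dotProduct, Fintype.sum_sigma]
    refine Finset.sum_congr rfl fun i _ => ?_
    rw [ofVec_mul_coeff]
    refine Finset.sum_congr rfl fun r _ => ?_
    rw [phi_eq_sigma]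
    rfl
  constructor
  · intro h
    ext c
    rcases Nat.lt_or_ge c k with hc | hc
    · have := hcoeff ⟨c, hc⟩
      rw [h] at this
      exact this.symm
    · refine Submodule.sum_mem (degreeLT _ k) (fun i _ => ?_) c hc
      refine degreeLT_mono ?_ (mul_mem_degreeLT (ofVec_mem_degreeLT fun r => v ⟨i, r⟩)
        (monicOfDegree_skewF (F := F) ha (Z i) (τ i)).1)
      have := hZ i
      omega
  · intro h
    ext c
    rw [hcoeff, h]
    rfl

theorem noRelation_iff_vecMul (ha : ∀ l, a l ≠ 0) (hZ : ∀ i, τ i + (Z i).card ≤ k) :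
    NoRelation F a k Z τ ↔ ∀ v : (Σ i : Fin s, Fin (k - τ i - (Z i).card)) → Rn F K nl,
      Matrix.vecMul v (stackedMat F a k Z τ) = 0 → v = 0 := by
  constructor
  · intro h v hv
    ext ⟨i, r⟩
    have := h (fun i => ofVec (k - τ i - (Z i).card) (fun r => v ⟨i, r⟩))
      (fun i => by
        rw [← Nat.sub_sub]
        exact ofVec_mem_degreeLT _) ((vecMul_stackedMat ha hZ v).mp hv) i
    exact congr_fun (eq_zero_of_ofVec_eq_zero this) r
  · intro h g hg hrel i
    simp only [← Nat.sub_sub] at hg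
    have hv := h (fun p => (g p.1).coeff p.2) ((vecMul_stackedMat ha hZ _).mpr (by
      simp only [fun i => ofVec_coeff (hg i)]
      exact hrel))
    rw [← ofVec_coeff (hg i)]
    have : (fun r : Fin (k - τ i - (Z i).card) => (g i).coeff r) = 0 :=
      funext fun r => congr_fun hv ⟨i, r⟩
    rw [this]
    ext m
    rw [coeff_ofVec]
    split_ifs <;> rfl

theorem noRelation_iff_rank (ha : ∀ l, a l ≠ 0) (hZ : ∀ i, τ i + (Z i).card ≤ k) :
    NoRelation F a k Z τ ↔ (stackedMat F a k Z τ).rank =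
      Fintype.card (Σ i : Fin s, Fin (k - τ i - (Z i).card)) := by
  rw [noRelation_iff_vecMul ha hZ]
  exact ⟨rank_eq_card_of_vecMul _, fun h v hv => eq_zero_of_vecMul_eq_zero_of_rank_eq _ h hv⟩

/-- When all `𝖿(Z_i,0)` have degree `k - 1`, the multipliers in a relation are constants. -/
theorem noRelation_iff_det {Z : Fin k → Finset (Fin (∑ l, nl l))} (ha : ∀ l, a l ≠ 0)
    (hk : 1 ≤ k) (hZ : ∀ i, (Z i).card = k - 1) :
    NoRelation F a k Z (fun _ => 0) ↔ (coeffMat F a Z).det ≠ 0 := by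
  have hone : ∀ i, k - (0 + (Z i).card) = 1 := fun i => by
    rw [hZ i]
    omega
  have hvec : ∀ v : Fin k → Rn F K nl, Matrix.vecMul v (coeffMat F a Z) = 0 ↔
      ∑ i, C (v i) * skewF F a (Z i) 0 = 0 := by
    intro v
    have hcoeff : ∀ c : Fin k, Matrix.vecMul v (coeffMat F a Z) c =
        (∑ i, C (v i) * skewF F a (Z i) 0).coeff c := by
      intro c
      rw [coeff_sum, Matrix.vecMul, dotProduct]
      exact Finset.sum_congr rfl fun i _ => (coeff_C_mul (v i) (skewF F a (Z i) 0) c).symm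
    constructor
    · intro h
      ext c
      rcases Nat.lt_or_ge c k with hc | hc
      · have := hcoeff ⟨c, hc⟩
        rw [h] at this
        exact this.symm
      · refine Submodule.sum_mem (degreeLT _ k) (fun i _ => ?_) c hc
        have := mul_mem_degreeLT (C_mem_degreeLT (v i))
          (monicOfDegree_skewF (F := F) ha (Z i) 0).1
        refine degreeLT_mono ?_ this
        have := hone i
        omega
    · intro h
      ext c
      rw [hcoeff, h]
      rfl
  rw [Ne, ← Matrix.exists_vecMul_eq_zero_iff]
  push Not
  constructor
  · intro h v hv0 hv
    refine hv0 (funext fun i => ?_)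
    exact SkewPolynomial.C_eq_zero.mp (h (fun i => C (v i))
      (fun i => by
        rw [hone i]
        exact C_mem_degreeLT _) ((hvec v).mp hv) i)
  · intro h g hg hrel i
    have hgC : ∀ i, g i = C ((g i).coeff 0) := fun i => by
      have := hg i
      rw [hone i] at this
      exact eq_C_of_mem_degreeLT_one this
    by_contra hne
    refine h (fun i => (g i).coeff 0) (fun h0 => hne ?_) ((hvec _).mpr ?_)
    · rw [hgC i, show (g i).coeff 0 = 0 from congr_fun h0 i, SkewPolynomial.C_0]
    · simp only [← hgC]
      exact hrel

theorem natDegree_gcrd (ha : ∀ l, a l ≠ 0) {Ω : Finset (Fin s)} (hΩ : Ω.Nonempty) :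
    natDegree (gcrd {p | ∃ i ∈ Ω, p = skewF F a (Z i) (τ i)}) =
      Ω.inf' hΩ τ + (Ω.inf' hΩ Z).card := by
  have h := isGcrd_iff (F := F) ha Z τ hΩ
  rw [(h _).mp (isGcrd_gcrd ⟨_, (h _).mpr rfl⟩)]
  exact (monicOfDegree_skewF ha _ _).natDegree_eq

end Main

end SkewCode

theorem mainTheorem2 {F K : Type*} [Field F] [Fintype F] [Field K] [Finite K] [Algebra F K]
    {ℓ : ℕ} (nl : Fin ℓ → ℕ) (a : Fin ℓ → K) (ha : ∀ l, a l ≠ 0)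
    (hconj : ∀ l l', l ≠ l' → ¬ SkewCode.SigmaConj F (a l) (a l')) (k : ℕ) :
    (∀ s : ℕ, 1 ≤ s → s ≤ k →
      ∀ (Z : Fin s → Finset (Fin (∑ l, nl l))) (τ : Fin s → ℕ)
        (f : Fin s → SkewPolynomial (SkewCode.Rn F K nl)),
        (∀ i, (Z i).card + τ i ≤ k - 1) →
        (∀ i, f i = SkewCode.skewF F a (Z i) (τ i)) →
        -- the lclm's and gcrd's that occur exist and are unique
        (∀ i, ∃! m, SkewCode.IsLclm (SkewCode.linearFactors F a (Z i)) m) ∧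
        (∀ Ω : Finset (Fin s), Ω.Nonempty → ∃! g, SkewCode.IsGcrd {p | ∃ i ∈ Ω, p = f i} g) ∧
        -- (i) is equivalent to (ii)
        ((∀ g : Fin s → SkewPolynomial (SkewCode.Rn F K nl),
            (∀ i, SkewCode.degree (g i * f i) ≤ ((k - 1 : ℕ) : WithBot ℕ)) →
            ∑ i, g i * f i = 0 → ∀ i, g i = 0) ↔
          (∀ Ω : Finset (Fin s), Ω.Nonempty →
            (k : ℤ) - SkewCode.natDegree (SkewCode.gcrd {p | ∃ i ∈ Ω, p = f i}) ≥
              ∑ i ∈ Ω, ((k : ℤ) - SkewCode.natDegree (f i)))) ∧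
        -- the matrix form
        ((SkewCode.stackedMat F a k Z τ).rank =
            Fintype.card (Σ i : Fin s, Fin (k - τ i - (Z i).card)) ↔
          (∀ (Ω : Finset (Fin s)) (hΩ : Ω.Nonempty),
            (k : ℤ) - (Ω.inf' hΩ Z).card - (Ω.inf' hΩ τ : ℕ) ≥
              ∑ i ∈ Ω, ((k : ℤ) - τ i - (Z i).card)))) ∧
    -- the determinant of the coefficient matrix and the GM-MDS condition
    (∀ Z : Fin k → Finset (Fin (∑ l, nl l)), (∀ i, (Z i).card = k - 1) →
      ((SkewCode.coeffMat F a Z).det ≠ 0 ↔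
        ∀ (Ω : Finset (Fin k)) (hΩ : Ω.Nonempty), (Ω.inf' hΩ Z).card + Ω.card ≤ k)) := by
  refine ⟨?_, ?_⟩
  · intro s hs hsk Z τ f hZ hf
    obtain rfl : f = fun i => SkewCode.skewF F a (Z i) (τ i) := funext hf
    have hk : 1 ≤ k := hs.trans hsk
    have hZ' : ∀ i, τ i + (Z i).card ≤ k := fun i => by
      have := hZ i
      omega
    refine ⟨fun i => SkewCode.existsUnique_isLclm ha (Z i), ?_, ?_, ?_⟩
    · intro Ω hΩ
      have h := SkewCode.isGcrd_iff (F := F) ha Z τ hΩ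
      exact ⟨_, (h _).mpr rfl, fun y hy => (h y).mp hy⟩
    · rw [← SkewCode.noRelation_iff_degree ha hk hZ', SkewCode.noRelation_iff_dim ha hZ']
      refine forall_congr' fun Ω => forall_congr' fun hΩ => ?_
      rw [SkewCode.natDegree_gcrd ha hΩ]
      simp only [fun i => (SkewCode.monicOfDegree_skewF (F := F) ha (Z i) (τ i)).natDegree_eq]
      push_cast
      simp only [sub_sub, add_comm]
    · rw [← SkewCode.noRelation_iff_rank ha hZ', SkewCode.noRelation_iff_dim ha hZ']
  · intro Z hZ
    rcases Nat.eq_zero_or_pos k with rfl | hk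
    · refine iff_of_true ?_ fun Ω hΩ => hΩ.elim fun i _ => i.elim0
      rw [Matrix.det_isEmpty]
      exact one_ne_zero
    rw [← SkewCode.noRelation_iff_det ha hk hZ, SkewCode.noRelation_iff_dim ha (fun i => by
      rw [hZ i]
      omega)]
    refine forall_congr' fun Ω => forall_congr' fun hΩ => ?_
    have hsum : ∑ i ∈ Ω, ((k : ℤ) - ((0 : ℕ) : ℤ) - (Z i).card) = Ω.card := by
      rw [Finset.card_eq_sum_ones, Nat.cast_sum]
      refine Finset.sum_congr rfl fun i _ => ?_
      rw [hZ i]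
      omega
    rw [hsum, Finset.inf'_const]
    omega
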